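/- Let $\mathbb D$ be the open unit disc in $\mathbb C$, $dA$ the Lebesgue area measure on $\mathbb D$, and $\varphi_a(z)=\frac{a-z}{1-\overline a z}$ for $a,z\in\mathbb D$. For a subarc $I\subseteq\partial\mathbb D$ let $|I|\in(0,1]$ be its normalized length (so that $|\partial\mathbb D|=1$), and let $S(I)=\{z\in\mathbb D:\ 1-|I|<|z|<1,\ z/|z|\in I\}$. For $p>1$ and $0<t\le 1$, let $F(p,p-2,t)$ be the space of all holomorphic functions $f$ on $\mathbb D$ with $$\|f\|_{F(p,p-2,t)}:=|f(0)|+\sup_{a\in\mathbb D}\left(\int_{\mathbb D}|f'(z)|^p(1-|z|^2)^{p-2}(1-|\varphi_a(z)|^2)^t\,dA(z)\right)^{1/p}<\infty .$$ For a positive Borel measure $\mu$ on $\mathbb D$ and $0<s\le 1$, let $\mathcal T^p_{s,p}(\mu)$ be the space of all holomorphic functions $f$ on $\mathbb D$ with $$\|f\|_{\mathcal T^p_{s,p}(\mu)}:=\sup_{I\subseteq\partial\mathbb D}\left(\frac{1}{|I|^s\left(\log\frac{2}{|I|}\right)^p}\int_{S(I)}|f(z)|^p\,d\mu(z)\right)^{1/p}<\infty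 ,$$ and call $\mu$ an $s$-Carleson measure if $\sup_{I\subseteq\partial\mathbb D}\mu(S(I))/|I|^s<\infty$. Both suprema are over all subarcs $I$ of positive length. **Theorem.** Let $p>1$, $0<t<s\le 1$, and let $\mu$ be a positive Borel measure on $\mathbb D$. Then the identity map $F(p,p-2,t)\to\mathcal T^p_{s,p}(\mu)$ is bounded, that is, $F(p,p-2,t)\subseteq\mathcal T^p_{s,p}(\mu)$ and there is a constant $C<\infty$ with $\|f\|_{\mathcal T^p_{s,p}(\mu)}\le C\|f\|_{F(p,p-2,t)}$ for all $f\in F(p,p-2,t)$, if and only if $\mu$ is an $s$-Carleson measure. -/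

import Mathlib

open MeasureTheory Metric
open scoped NNReal ENNReal ComplexConjugate

namespace NearEndpoint

/-- The disc automorphism `φ_a(z) = (a - z) / (1 - conj a * z)`. -/
noncomputable def mobius (a z : ℂ) : ℂ := (a - z) / (1 - conj a * z)

/-- The norm of `F(p, q, s)`, with values in `[0, ∞]`; `volume` on `ℂ` is the planar Lebesgue
measure `dA`. -/
noncomputable def fNorm (p q s : ℝ) (f : ℂ → ℂ) : ℝ≥0∞ :=
  ‖f 0‖ₑ + ⨆ a ∈ ball (0 : ℂ) 1,
    (∫⁻ z in ball (0 : ℂ) 1,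
      ENNReal.ofReal (‖deriv f z‖ ^ p * (1 - ‖z‖ ^ 2) ^ q * (1 - ‖mobius a z‖ ^ 2) ^ s)) ^ (1 / p)

/-- The space `F(p, q, s)` of holomorphic functions on the unit disc. -/
def FSpace (p q s : ℝ) : Set (ℂ → ℂ) :=
  {f | DifferentiableOn ℂ f (ball 0 1) ∧ fNorm p q s f < ∞}

/-- The closed subarc of the unit circle with centre `exp (iθ)` and normalized length `ℓ`
(the whole circle has length `1`). -/
def arc (θ ℓ : ℝ) : Set ℂ :=
  {w | ∃ x : ℝ, |x - θ| ≤ Real.pi * ℓ ∧ w = Complex.exp (x * Complex.I)}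

/-- The Carleson tent over the arc `arc θ ℓ`. -/
def tent (θ ℓ : ℝ) : Set ℂ :=
  {z | 1 - ℓ < ‖z‖ ∧ ‖z‖ < 1 ∧ z / (‖z‖ : ℂ) ∈ arc θ ℓ}

/-- The norm of the tent space `T^p_{s,p}(μ)`, with values in `[0, ∞]`. The supremum runs over all
closed subarcs of the circle, the circle itself included; other subarcs would not change it, because
an arc without one or both endpoints is an increasing union of closed arcs. -/
noncomputable def tentNorm (s p : ℝ) (μ : Measure ℂ) (f : ℂ → ℂ) : ℝ≥0∞ :=
  ⨆ (θ : ℝ) (ℓ ∈ Set.Ioc (0 : ℝ) 1),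
    ((∫⁻ z in tent θ ℓ, ‖f z‖ₑ ^ p ∂μ) /
      ENNReal.ofReal (ℓ ^ s * Real.log (2 / ℓ) ^ p)) ^ (1 / p)

/-- The tent space `T^p_{s,p}(μ)` of holomorphic functions on the unit disc. -/
def TentSpace (s p : ℝ) (μ : Measure ℂ) : Set (ℂ → ℂ) :=
  {f | DifferentiableOn ℂ f (ball 0 1) ∧ tentNorm s p μ f < ∞}

/-- The `s`-Carleson norm of a measure, with values in `[0, ∞]`. -/
noncomputable def carlesonNorm (s : ℝ) (μ : Measure ℂ) : ℝ≥0∞ :=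
  ⨆ (θ : ℝ) (ℓ ∈ Set.Ioc (0 : ℝ) 1), μ (tent θ ℓ) / ENNReal.ofReal (ℓ ^ s)

/-- `μ` is an `s`-Carleson measure. -/
def IsCarleson (s : ℝ) (μ : Measure ℂ) : Prop := carlesonNorm s μ < ∞

end NearEndpoint

namespace NearEndpoint

/-! Sufficiency. Over an arc of length `ℓ`, write `f z` as the value at the point of radius `1 - ℓ`
on the same ray plus a radial increment. The sub-mean value property of `‖f'‖ ^ p` on hyperbolic
discs gives the Bloch bound `‖f' w‖ ≲ N / (1 - ‖w‖)` with `N = fNorm p (p - 2) t f`. Integrated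
along a ray, it bounds the first piece by `N * log (2 / ℓ)`. This is the only source of the
logarithm, and `μ (tent) ≲ ℓ ^ s` finishes that piece.

The increment needs no logarithm. With `ε = s - t > 0`, Hölder's inequality bounds its `p`-th power
by `ℓ ^ ε` times the radial integral of `‖f'‖ ^ p (1 - ρ) ^ (p - 1 - ε)`. Replace `‖f'‖ ^ p` by its
area mean over a disc of radius `(1 - ρ) / 2`, integrate over the tent and apply Tonelli. A point
`ζ` is seen only by those `(z, ρ)` with `z` in a tent of size `≲ 1 - ‖ζ‖` and `ρ` in an interval of
that length, a set of measure `≲ (1 - ‖ζ‖) ^ (s + 1)`. The resulting weight `(1 - ‖ζ‖) ^ (p - 2 +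
t)` is at most `ℓ ^ t` times the weight of `F(p, p - 2, t)` at `a = tentCenter θ ℓ`, because `1 -
‖φ_a ζ‖ ^ 2 ≳ (1 - ‖ζ‖) / ℓ` on the window. The powers combine to `ℓ ^ (s - t) * ℓ ^ t = ℓ ^ s`. The
steps are `enorm_le_log_mul_fNorm`, `enorm_sub_rpow_le_lintegral_radial`, `lintegral_tent_radial_le`
and `lintegral_window_le`.

Necessity. The functions `log 12 - log (1 - conj a * z)` are bounded in `F(p, p - 2, t)` uniformly
in `a` (`fNorm_logTest_le`), and for `a = tentCenter θ ℓ` they have modulus at least `log (2 / ℓ)`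
on the tent (`log_le_norm_logTest`). The logarithms cancel in the tent norm and leave `μ (tent) / ℓ
^ s`. -/

/-! ### Polar coordinates and sub-mean value properties -/

/-- Integration over a disc in polar coordinates. -/
theorem lintegral_ball_eq_polar {F : ℂ → ℝ≥0∞} (hF : Measurable F) (R : ℝ) :
    ∫⁻ z in ball (0 : ℂ) R, F z =
      ∫⁻ r in Set.Ioo 0 R, ENNReal.ofReal r *
        ∫⁻ θ in Set.Ioo (-Real.pi) Real.pi, F (r * Complex.exp (θ * Complex.I)) := by
  have hsymm : ∀ q : ℝ × ℝ,
      Complex.polarCoord.symm q = (q.1 : ℂ) * Complex.exp (q.2 * Complex.I) := fun q => by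
    rw [Complex.polarCoord_symm_apply, Complex.exp_mul_I]
    simp
  have hmeas : Measurable fun q : ℝ × ℝ =>
      ENNReal.ofReal q.1 * (ball (0 : ℂ) R).indicator F (q.1 * Complex.exp (q.2 * Complex.I)) := by
    refine Measurable.mul (by fun_prop) ((hF.indicator measurableSet_ball).comp (by fun_prop))
  rw [← lintegral_indicator measurableSet_ball, ← Complex.lintegral_comp_polarCoord_symm]
  simp only [hsymm, smul_eq_mul]
  rw [show polarCoord.target = Set.Ioi (0 : ℝ) ×ˢ Set.Ioo (-Real.pi) Real.pi from rfl,
    Measure.volume_eq_prod, setLIntegral_prod _ hmeas.aemeasurable,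
    ← lintegral_indicator measurableSet_Ioi, ← lintegral_indicator measurableSet_Ioo]
  refine lintegral_congr fun r => ?_
  by_cases h0 : 0 < r
  · have hmem : ∀ θ : ℝ, ((r : ℂ) * Complex.exp (θ * Complex.I) ∈ ball (0 : ℂ) R) ↔ r < R := by
      intro θ
      simp [Complex.norm_exp_ofReal_mul_I, abs_of_pos h0]
    by_cases hR : r < R
    · rw [Set.indicator_of_mem (Set.mem_Ioi.2 h0), Set.indicator_of_mem (Set.mem_Ioo.2 ⟨h0, hR⟩)]
      rw [lintegral_const_mul' _ _ ENNReal.ofReal_ne_top]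
      congr 1
      refine lintegral_congr fun θ => ?_
      rw [Set.indicator_of_mem ((hmem θ).2 hR)]
    · rw [Set.indicator_of_mem (Set.mem_Ioi.2 h0), Set.indicator_of_notMem (fun h : r ∈ Set.Ioo 0 R => hR h.2)]
      simp only [Set.indicator_of_notMem (fun h => hR ((hmem _).1 h)), mul_zero, lintegral_zero]
  · rw [Set.indicator_of_notMem (fun h : r ∈ Set.Ioi 0 => h0 h),
      Set.indicator_of_notMem (fun h : r ∈ Set.Ioo 0 R => h0 h.1)]

theorem enorm_center_le_lintegral_circle {g : ℂ → ℂ} {c : ℂ} {r : ℝ} (hr : 0 < r)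
    (hg : DifferentiableOn ℂ g (closedBall c r)) :
    ENNReal.ofReal (2 * Real.pi) * ‖g c‖ₑ ≤
      ∫⁻ θ in Set.Ioo (-Real.pi) Real.pi, ‖g (c + r * Complex.exp (θ * Complex.I))‖ₑ := by
  have hd : DiffContOnCl ℂ g (ball c |r|) := by
    rw [abs_of_pos hr]
    exact (hg.mono closure_ball_subset_closedBall).diffContOnCl
  have h := hd.circleAverage
  rw [Real.circleAverage_def] at h
  have hper : Function.Periodic (fun θ => g (circleMap c r θ)) (2 * Real.pi) := fun θ => by
    simp only [periodic_circleMap c r θ]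
  have h2 := hper.intervalIntegral_add_eq 0 (-Real.pi)
  rw [zero_add, show -Real.pi + 2 * Real.pi = Real.pi by ring] at h2
  rw [h2] at h
  have hpi := Real.pi_pos
  have h3 : (2 * Real.pi) • g c = ∫ θ in (-Real.pi)..Real.pi, g (circleMap c r θ) := by
    rw [← h, smul_smul, mul_inv_cancel₀ (by positivity), one_smul]
  rw [intervalIntegral.integral_of_le (by linarith), integral_Ioc_eq_integral_Ioo] at h3
  calc ENNReal.ofReal (2 * Real.pi) * ‖g c‖ₑ = ‖(2 * Real.pi) • g c‖ₑ := by
        rw [enorm_smul, Real.enorm_of_nonneg (by positivity)]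
    _ ≤ _ := by
        rw [h3]
        exact enorm_integral_le_lintegral_enorm _

theorem lintegral_ofReal_Ioo_zero {R : ℝ} (hR : 0 < R) :
    ∫⁻ r in Set.Ioo 0 R, ENNReal.ofReal r = ENNReal.ofReal (R ^ 2 / 2) := by
  rw [← ofReal_integral_eq_lintegral_ofReal, ← integral_Ioc_eq_integral_Ioo,
    ← intervalIntegral.integral_of_le hR.le, integral_id]
  · congr 1; ring
  · exact (continuous_id.integrableOn_Icc (a := 0) (b := R)).mono_set Set.Ioo_subset_Icc_self
  · filter_upwards [ae_restrict_mem measurableSet_Ioo] with r hr using hr.1.le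

/-- The area form of the sub-mean value property of `‖g‖`. -/
theorem enorm_center_le_lintegral_ball {g : ℂ → ℂ} (hgm : Measurable g) {c : ℂ} {R : ℝ}
    (hR : 0 < R) (hg : DifferentiableOn ℂ g (ball c R)) :
    ‖g c‖ₑ * volume (ball c R) ≤ ∫⁻ z in ball c R, ‖g z‖ₑ := by
  have htrans : ∫⁻ z in ball c R, ‖g z‖ₑ = ∫⁻ z in ball (0 : ℂ) R, ‖g (c + z)‖ₑ := by
    rw [← lintegral_indicator measurableSet_ball, ← lintegral_indicator measurableSet_ball,
      ← lintegral_add_left_eq_self ((ball c R).indicator fun z => ‖g z‖ₑ) c]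
    refine lintegral_congr fun z => ?_
    classical
    simp [Set.indicator_apply]
  rw [htrans, lintegral_ball_eq_polar (F := fun z => ‖g (c + z)‖ₑ)
    ((hgm.comp (measurable_const_add c)).enorm)]
  calc ‖g c‖ₑ * volume (ball c R)
      = ∫⁻ r in Set.Ioo 0 R, ENNReal.ofReal r * (ENNReal.ofReal (2 * Real.pi) * ‖g c‖ₑ) := by
        rw [lintegral_mul_const' _ _ (ENNReal.mul_ne_top ENNReal.ofReal_ne_top enorm_ne_top),
          lintegral_ofReal_Ioo_zero hR, ← mul_assoc, ← ENNReal.ofReal_mul (by positivity),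
          Complex.volume_ball, mul_comm, ← ENNReal.ofReal_pow hR.le]
        congr 1
        rw [show ((NNReal.pi : ℝ≥0) : ℝ≥0∞) = ENNReal.ofReal Real.pi by
          rw [← NNReal.coe_real_pi, ENNReal.ofReal_coe_nnreal], ← ENNReal.ofReal_mul (by positivity)]
        congr 1; ring
    _ ≤ _ := by
        refine setLIntegral_mono' measurableSet_Ioo fun r hr => ?_
        gcongr
        refine enorm_center_le_lintegral_circle hr.1 (hg.mono ?_)
        exact closedBall_subset_ball hr.2

/-- Hölder's inequality for a power of an integral. -/
theorem lintegral_mul_rpow_le {α : Type*} [MeasurableSpace α] (ν : Measure α) {p : ℝ} (hp : 1 < p)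
    {u v : α → ℝ≥0∞} (hu : AEMeasurable u ν) (hv : AEMeasurable v ν) :
    (∫⁻ x, u x * v x ∂ν) ^ p ≤
      (∫⁻ x, u x ^ p ∂ν) * (∫⁻ x, v x ^ (p / (p - 1)) ∂ν) ^ (p - 1) := by
  have hc : p.HolderConjugate (p / (p - 1)) := Real.HolderConjugate.conjExponent hp
  have h := ENNReal.lintegral_mul_le_Lp_mul_Lq ν hc hu hv
  have hp0 : 0 < p := by linarith
  calc (∫⁻ x, u x * v x ∂ν) ^ p
      ≤ ((∫⁻ x, u x ^ p ∂ν) ^ (1 / p) *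
          (∫⁻ x, v x ^ (p / (p - 1)) ∂ν) ^ (1 / (p / (p - 1)))) ^ p := by
        gcongr
        exact h
    _ = _ := by
        rw [ENNReal.mul_rpow_of_nonneg _ _ hp0.le, ← ENNReal.rpow_mul, ← ENNReal.rpow_mul]
        have h1 : p - 1 ≠ 0 := by linarith
        congr 2
        · rw [one_div_mul_cancel hp0.ne', ENNReal.rpow_one]
        · field_simp

/-- The area form of the sub-mean value property of `‖g‖ ^ p`. -/
theorem enorm_rpow_center_le_lintegral_ball {g : ℂ → ℂ} (hgm : Measurable g) {c : ℂ} {R p : ℝ}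
    (hp : 1 < p) (hR : 0 < R) (hg : DifferentiableOn ℂ g (ball c R)) :
    ‖g c‖ₑ ^ p * volume (ball c R) ≤ ∫⁻ z in ball c R, ‖g z‖ₑ ^ p := by
  have hp0 : 0 < p := by linarith
  have hV0 : volume (ball c R) ≠ 0 := (measure_ball_pos volume c hR).ne'
  have hVt : volume (ball c R) ≠ ∞ := measure_ball_lt_top.ne
  have h1 := enorm_center_le_lintegral_ball hgm hR hg
  have h2 := lintegral_mul_rpow_le (volume.restrict (ball c R)) hp (u := fun z => ‖g z‖ₑ)
    (v := fun _ => 1) hgm.enorm.aemeasurable aemeasurable_const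
  simp only [mul_one, ENNReal.one_rpow, lintegral_one, Measure.restrict_apply MeasurableSet.univ,
    Set.univ_inter] at h2
  have h3 := (ENNReal.rpow_le_rpow h1 hp0.le).trans h2
  rw [ENNReal.mul_rpow_of_nonneg _ _ hp0.le] at h3
  -- Hölder against the constant `1` costs `V ^ (p - 1)`, which cancels all but one factor of `V ^
  -- p`.
  set V := volume (ball c R)
  have h4 : V ^ p = V * V ^ (p - 1) := by
    conv_lhs => rw [show p = 1 + (p - 1) by ring]
    rw [ENNReal.rpow_add _ _ hV0 hVt, ENNReal.rpow_one]
  rw [h4, ← mul_assoc] at h3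
  have hne0 : V ^ (p - 1) ≠ 0 := by simp [ENNReal.rpow_eq_zero_iff, hV0, hVt]
  have hnet : V ^ (p - 1) ≠ ∞ := ENNReal.rpow_ne_top_of_nonneg (by linarith) hVt
  exact (ENNReal.mul_le_mul_iff_left hne0 hnet).1 h3

/-! ### One-variable integrals and comparison of powers -/

theorem setLIntegral_one_sub (F : ℝ → ℝ≥0∞) (a b : ℝ) :
    ∫⁻ x in Set.Ioo (1 - b) (1 - a), F (1 - x) = ∫⁻ x in Set.Ioo a b, F x := by
  rw [← lintegral_indicator measurableSet_Ioo, ← lintegral_indicator measurableSet_Ioo,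
    ← lintegral_sub_left_eq_self ((Set.Ioo a b).indicator F) 1]
  refine lintegral_congr fun x => ?_
  by_cases h : 1 - x ∈ Set.Ioo a b
  · rw [Set.indicator_of_mem h, Set.indicator_of_mem]
    exact ⟨by linarith [h.2], by linarith [h.1]⟩
  · rw [Set.indicator_of_notMem h, Set.indicator_of_notMem]
    exact fun h' => h ⟨by linarith [h'.2], by linarith [h'.1]⟩

theorem setLIntegral_rpow_Ioo_zero {b δ : ℝ} (hb : 0 ≤ b) (hδ : 0 < δ) :
    ∫⁻ x in Set.Ioo 0 b, ENNReal.ofReal (x ^ (δ - 1)) = ENNReal.ofReal (b ^ δ / δ) := by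
  rw [← ofReal_integral_eq_lintegral_ofReal, ← integral_Ioc_eq_integral_Ioo,
    ← intervalIntegral.integral_of_le hb, integral_rpow (Or.inl (by linarith)), sub_add_cancel,
    Real.zero_rpow hδ.ne', sub_zero]
  · have := (intervalIntegral.intervalIntegrable_rpow' (a := 0) (b := b) (r := δ - 1)
      (by linarith)).1
    exact this.mono_set Set.Ioo_subset_Ioc_self
  · filter_upwards [ae_restrict_mem measurableSet_Ioo] with x hx using
      Real.rpow_nonneg hx.1.le _

theorem setLIntegral_rpow_Ioi {a δ : ℝ} (ha : 0 < a) (hδ : 0 < δ) :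
    ∫⁻ x in Set.Ioi a, ENNReal.ofReal (x ^ (-δ - 1)) = ENNReal.ofReal (a ^ (-δ) / δ) := by
  rw [← ofReal_integral_eq_lintegral_ofReal, integral_Ioi_rpow_of_lt (by linarith) ha,
    sub_add_cancel, neg_div_neg_eq]
  · exact integrableOn_Ioi_rpow_of_lt (by linarith) ha
  · filter_upwards [ae_restrict_mem measurableSet_Ioi] with x hx using
      Real.rpow_nonneg (ha.le.trans (le_of_lt hx)) _

theorem setLIntegral_inv_Ioo_one {a : ℝ} (ha : 0 < a) (ha1 : a ≤ 1) :
    ∫⁻ x in Set.Ioo a 1, ENNReal.ofReal x⁻¹ = ENNReal.ofReal (Real.log (1 / a)) := by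
  rw [← ofReal_integral_eq_lintegral_ofReal, ← integral_Ioc_eq_integral_Ioo,
    ← intervalIntegral.integral_of_le ha1, integral_inv_of_pos ha one_pos]
  · refine (ContinuousOn.integrableOn_Icc ?_).mono_set Set.Ioo_subset_Icc_self
    exact continuousOn_id.inv₀ fun x hx => (ha.trans_le hx.1).ne'
  · filter_upwards [ae_restrict_mem measurableSet_Ioo] with x hx using
      inv_nonneg.2 (ha.trans hx.1).le

/-- Powers of comparable positive numbers are comparable. -/
theorem rpow_le_mul_rpow_of_comparable {x y c : ℝ} (q : ℝ) (hx : 0 < x) (hc : 1 ≤ c)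
    (h1 : x ≤ c * y) (h2 : y ≤ c * x) : y ^ q ≤ c ^ |q| * x ^ q := by
  have hc0 : 0 < c := by linarith
  have hy : 0 < y := by
    by_contra h
    nlinarith
  rcases le_total 0 q with hq | hq
  · rw [abs_of_nonneg hq, ← Real.mul_rpow hc0.le hx.le]
    exact Real.rpow_le_rpow hy.le h2 hq
  · rw [abs_of_nonpos hq]
    have h3 : y ^ q ≤ (x / c) ^ q :=
      Real.rpow_le_rpow_of_nonpos (by positivity) (by rw [div_le_iff₀ hc0]; linarith) hq
    rw [Real.div_rpow hx.le hc0.le] at h3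
    rw [Real.rpow_neg hc0.le, inv_mul_eq_div]
    exact h3

theorem enorm_rpow_eq_ofReal (z : ℂ) {p : ℝ} (hp : 0 ≤ p) :
    ‖z‖ₑ ^ p = ENNReal.ofReal (‖z‖ ^ p) := by
  rw [← ofReal_norm, ENNReal.ofReal_rpow_of_nonneg (norm_nonneg _) hp]

/-! ### Möbius weights and the defining integrals -/

theorem one_sub_norm_mobius_sq {a z : ℂ} (h : 1 - conj a * z ≠ 0) :
    1 - ‖mobius a z‖ ^ 2 = (1 - ‖a‖ ^ 2) * (1 - ‖z‖ ^ 2) / ‖1 - conj a * z‖ ^ 2 := by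
  have h0 : ‖1 - conj a * z‖ ^ 2 ≠ 0 := by simpa using h
  rw [mobius, norm_div, div_pow, eq_div_iff h0, sub_mul, div_mul_cancel₀ _ h0, one_mul]
  simp only [← Complex.normSq_eq_norm_sq, Complex.normSq_apply, Complex.sub_re, Complex.sub_im,
    Complex.mul_re, Complex.mul_im, Complex.conj_re, Complex.conj_im, Complex.one_re,
    Complex.one_im]
  ring

theorem one_sub_norm_le_norm_one_sub_conj_mul {a z : ℂ} :
    1 - ‖a‖ * ‖z‖ ≤ ‖1 - conj a * z‖ := by
  have := norm_sub_norm_le (1 : ℂ) (conj a * z)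
  simpa using this

theorem norm_one_sub_conj_mul_pos {a z : ℂ} (ha : ‖a‖ < 1) (hz : ‖z‖ < 1) :
    0 < ‖1 - conj a * z‖ := by
  refine lt_of_lt_of_le ?_ one_sub_norm_le_norm_one_sub_conj_mul
  nlinarith [norm_nonneg a, norm_nonneg z]

/-- The defining integrals are controlled by the norm. -/
theorem lintegral_le_fNorm_rpow {p q t : ℝ} (hp : 0 < p) (f : ℂ → ℂ) {a : ℂ}
    (ha : a ∈ ball (0 : ℂ) 1) :
    ∫⁻ z in ball (0 : ℂ) 1,
      ENNReal.ofReal (‖deriv f z‖ ^ p * (1 - ‖z‖ ^ 2) ^ q * (1 - ‖mobius a z‖ ^ 2) ^ t) ≤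
    fNorm p q t f ^ p := by
  have h : (∫⁻ z in ball (0 : ℂ) 1, ENNReal.ofReal
      (‖deriv f z‖ ^ p * (1 - ‖z‖ ^ 2) ^ q * (1 - ‖mobius a z‖ ^ 2) ^ t)) ^ (1 / p) ≤
      fNorm p q t f :=
    (le_iSup₂ (f := fun (a : ℂ) (_ : a ∈ ball (0 : ℂ) 1) => (∫⁻ z in ball (0 : ℂ) 1, ENNReal.ofReal
      (‖deriv f z‖ ^ p * (1 - ‖z‖ ^ 2) ^ q * (1 - ‖mobius a z‖ ^ 2) ^ t)) ^ (1 / p)) a ha).trans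
      le_add_self
  rw [one_div] at h
  exact (ENNReal.rpow_inv_le_iff hp).1 h

/-- Used twice, each time with the base point `a` adapted to `E`: the centre of a hyperbolic disc
for the Bloch bound, and the centre of a tent for the window estimate. -/
theorem setLIntegral_deriv_le_fNorm {p q t : ℝ} (hp : 0 < p) (f : ℂ → ℂ) {a : ℂ}
    (ha : a ∈ ball (0 : ℂ) 1) {E : Set ℂ} (hE : MeasurableSet E) (hEb : E ⊆ ball 0 1) {K : ℝ≥0∞}
    (hK : K ≠ ∞) {w : ℂ → ℝ≥0∞}
    (hw : ∀ z ∈ E, w z ≤ K * ENNReal.ofReal ((1 - ‖z‖ ^ 2) ^ q * (1 - ‖mobius a z‖ ^ 2) ^ t)) :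
    ∫⁻ z in E, ‖deriv f z‖ₑ ^ p * w z ≤ K * fNorm p q t f ^ p := by
  calc ∫⁻ z in E, ‖deriv f z‖ₑ ^ p * w z
      ≤ ∫⁻ z in E, K * ENNReal.ofReal
          (‖deriv f z‖ ^ p * (1 - ‖z‖ ^ 2) ^ q * (1 - ‖mobius a z‖ ^ 2) ^ t) := by
        refine setLIntegral_mono' hE fun z hz => ?_
        rw [mul_assoc (‖deriv f z‖ ^ p), ENNReal.ofReal_mul (by positivity),
          ← enorm_rpow_eq_ofReal _ hp.le, mul_left_comm]
        gcongr
        exact hw z hz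
    _ = K * ∫⁻ z in E, ENNReal.ofReal
          (‖deriv f z‖ ^ p * (1 - ‖z‖ ^ 2) ^ q * (1 - ‖mobius a z‖ ^ 2) ^ t) :=
        lintegral_const_mul' _ _ hK
    _ ≤ K * fNorm p q t f ^ p := by
        gcongr
        exact (lintegral_mono_set hEb).trans (lintegral_le_fNorm_rpow hp f ha)

/-! ### Bloch bound, logarithmic growth and radial increments -/

/-- The constant in the Bloch type estimate. -/
noncomputable def blochConst (p t : ℝ) : ℝ :=
  (4 / Real.pi * (3 ^ |p - 2| * (25 / 2) ^ t)) ^ (1 / p)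

theorem blochConst_nonneg (p t : ℝ) : 0 ≤ blochConst p t := by
  unfold blochConst
  positivity

theorem norm_bounds_of_mem_ball_half {w z : ℂ} (hz : z ∈ ball w ((1 - ‖w‖) / 2)) :
    (1 - ‖w‖) / 2 ≤ 1 - ‖z‖ ∧ 1 - ‖z‖ ≤ 3 / 2 * (1 - ‖w‖) := by
  rw [mem_ball, dist_eq_norm] at hz
  have h1 := norm_sub_norm_le z w
  have h2 := norm_sub_norm_le w z
  rw [norm_sub_rev] at h2
  constructor <;> linarith

/-- On the disc of radius `(1 - ‖w‖) / 2` about `w`, the weight of the integral with `a = w` is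
comparable to `(1 - ‖w‖) ^ (p - 2)`, since `1 - ‖φ_w‖ ^ 2` is bounded below there. The area mean of
`‖f'‖ ^ p` is then at most a constant times `N ^ p (1 - ‖w‖) ^ (-p)`. -/
theorem enorm_deriv_le_fNorm {p t : ℝ} (hp : 1 < p) (ht : 0 < t) {f : ℂ → ℂ}
    (hf : DifferentiableOn ℂ f (ball 0 1)) {w : ℂ} (hw : w ∈ ball (0 : ℂ) 1) :
    ‖deriv f w‖ₑ ≤
      ENNReal.ofReal (blochConst p t) * fNorm p (p - 2) t f * ENNReal.ofReal (1 - ‖w‖)⁻¹ := by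
  have hp0 : 0 < p := by linarith
  have hw1 : ‖w‖ < 1 := by simpa using hw
  set x := 1 - ‖w‖ with hx
  have hx0 : 0 < x := by linarith
  have hsub : ball w (x / 2) ⊆ ball 0 1 := fun z hz => by
    have := (norm_bounds_of_mem_ball_half hz).1
    simp only [mem_ball, dist_zero_right]
    linarith
  have hdf : DifferentiableOn ℂ (deriv f) (ball w (x / 2)) :=
    (hf.deriv isOpen_ball).mono hsub
  have h1 := enorm_rpow_center_le_lintegral_ball (measurable_deriv f) hp (half_pos hx0) hdf
  have h2 := setLIntegral_deriv_le_fNorm (p := p) (q := p - 2) (t := t) hp0 f hw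
    (E := ball w (x / 2)) measurableSet_ball hsub
    (K := ENNReal.ofReal (3 ^ |p - 2| * (25 / 2) ^ t * x ^ (2 - p))) ENNReal.ofReal_ne_top
    (w := fun _ => 1) (by
      intro z hz
      have hb := norm_bounds_of_mem_ball_half hz
      rw [← ENNReal.ofReal_mul (by positivity), ← ENNReal.ofReal_one]
      apply ENNReal.ofReal_le_ofReal
      have hz1 : ‖z‖ < 1 := by linarith [hb.1]
      have hzn := norm_nonneg z
      have hy1 : x / 2 ≤ 1 - ‖z‖ ^ 2 := by nlinarith [hb.1]
      have hy2 : 1 - ‖z‖ ^ 2 ≤ 3 * x := by nlinarith [hb.2]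
      have hden := norm_one_sub_conj_mul_pos hw1 hz1
      -- `1 - ‖w‖ ^ 2 ≤ 2 * x`, and moving from `w` to `z` costs at most `x / 2`.
      have hden2 : ‖1 - conj w * z‖ ≤ 5 / 2 * x := by
        have e : 1 - conj w * z = ((1 - ‖w‖ ^ 2 : ℝ) : ℂ) + conj w * (w - z) := by
          push_cast
          rw [← Complex.conj_mul']
          ring
        rw [e]
        have hwn := norm_nonneg w
        rw [mem_ball, dist_eq_norm, norm_sub_rev] at hz
        refine (norm_add_le _ _).trans ?_
        rw [Complex.norm_real, Real.norm_of_nonneg (by nlinarith), norm_mul, RCLike.norm_conj]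
        nlinarith [norm_nonneg (w - z)]
      -- The ratio of `x * (x / 2)` to `(5 / 2 * x) ^ 2`.
      have hm : 2 / 25 ≤ 1 - ‖mobius w z‖ ^ 2 := by
        rw [one_sub_norm_mobius_sq (norm_pos_iff.1 hden), le_div_iff₀ (by positivity)]
        have : x ≤ 1 - ‖w‖ ^ 2 := by nlinarith [norm_nonneg w]
        calc 2 / 25 * ‖1 - conj w * z‖ ^ 2 ≤ 2 / 25 * (5 / 2 * x) ^ 2 := by gcongr
          _ = x * (x / 2) := by ring
          _ ≤ _ := mul_le_mul this hy1 (by positivity) (by linarith)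
      have h3 : x ^ (p - 2) ≤ 3 ^ |p - 2| * (1 - ‖z‖ ^ 2) ^ (p - 2) :=
        rpow_le_mul_rpow_of_comparable _ (by linarith) (by norm_num) hy2 (by linarith)
      have h4 : (2 / 25 : ℝ) ^ t ≤ (1 - ‖mobius w z‖ ^ 2) ^ t :=
        Real.rpow_le_rpow (by norm_num) hm ht.le
      calc (1 : ℝ) = (25 / 2) ^ t * x ^ (2 - p) * (x ^ (p - 2) * (2 / 25) ^ t) := by
            rw [show (2 / 25 : ℝ) = (25 / 2)⁻¹ by norm_num, Real.inv_rpow (by norm_num),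
              show 2 - p = -(p - 2) by ring, Real.rpow_neg hx0.le]
            have : x ^ (p - 2) ≠ 0 := by positivity
            have : (25 / 2 : ℝ) ^ t ≠ 0 := by positivity
            field_simp
        _ ≤ (25 / 2) ^ t * x ^ (2 - p) *
              ((3 ^ |p - 2| * (1 - ‖z‖ ^ 2) ^ (p - 2)) * (1 - ‖mobius w z‖ ^ 2) ^ t) := by
            gcongr
            have : 0 ≤ 1 - ‖z‖ ^ 2 := by linarith
            positivity
        _ = _ := by ring)
  simp only [mul_one] at h2
  have h3 := h1.trans h2
  have hpi := Real.pi_pos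
  have hvol : volume (ball w (x / 2)) = ENNReal.ofReal (Real.pi / 4 * x ^ 2) := by
    rw [Complex.volume_ball, ← ENNReal.ofReal_pow (by positivity),
      show ((NNReal.pi : ℝ≥0) : ℝ≥0∞) = ENNReal.ofReal Real.pi by
        rw [← NNReal.coe_real_pi, ENNReal.ofReal_coe_nnreal], ← ENNReal.ofReal_mul (by positivity)]
    congr 1
    ring
  rw [hvol] at h3
  have h4 : ‖deriv f w‖ₑ ^ p ≤
      (ENNReal.ofReal (blochConst p t) * fNorm p (p - 2) t f * ENNReal.ofReal x⁻¹) ^ p := by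
    have e : (ENNReal.ofReal (blochConst p t) * fNorm p (p - 2) t f * ENNReal.ofReal x⁻¹) ^ p *
        ENNReal.ofReal (Real.pi / 4 * x ^ 2) =
        ENNReal.ofReal (3 ^ |p - 2| * (25 / 2) ^ t * x ^ (2 - p)) * fNorm p (p - 2) t f ^ p := by
      rw [ENNReal.mul_rpow_of_nonneg _ _ hp0.le, ENNReal.mul_rpow_of_nonneg _ _ hp0.le,
        ENNReal.ofReal_rpow_of_nonneg (blochConst_nonneg _ _) hp0.le,
        ENNReal.ofReal_rpow_of_nonneg (by positivity) hp0.le, blochConst,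
        ← Real.rpow_mul (by positivity), one_div_mul_cancel hp0.ne', Real.rpow_one]
      rw [show ∀ A B C D : ℝ≥0∞, A * B * C * D = A * C * D * B from fun A B C D => by ring,
        ← ENNReal.ofReal_mul (by positivity), ← ENNReal.ofReal_mul (by positivity)]
      congr 2
      rw [Real.inv_rpow hx0.le, Real.rpow_sub hx0, show x ^ (2 : ℝ) = x ^ 2 by norm_cast]
      field_simp
    rw [← e] at h3
    exact (ENNReal.mul_le_mul_iff_left (by simp; positivity) ENNReal.ofReal_ne_top).1 h3
  exact (ENNReal.rpow_le_rpow_iff hp0).1 h4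

theorem enorm_sub_le_lintegral_radial {f : ℂ → ℂ} (hf : DifferentiableOn ℂ f (ball 0 1)) {u : ℂ}
    (hu : ‖u‖ = 1) {r₀ r : ℝ} (h0 : 0 ≤ r₀) (h1 : r₀ ≤ r) (h2 : r < 1) :
    ‖f (r * u) - f (r₀ * u)‖ₑ ≤ ∫⁻ ρ in Set.Ioo r₀ r, ‖deriv f (ρ * u)‖ₑ := by
  have hmem : ∀ ρ ∈ Set.Icc r₀ r, (ρ * u : ℂ) ∈ ball (0 : ℂ) 1 := fun ρ hρ => by
    simp only [mem_ball, dist_zero_right, norm_mul, Complex.norm_real, hu, mul_one,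
      Real.norm_of_nonneg (h0.trans hρ.1)]
    exact hρ.2.trans_lt h2
  have hder : ∀ ρ ∈ Set.uIcc r₀ r,
      HasDerivAt (fun ρ : ℝ => f (ρ * u)) (deriv f (ρ * u) * u) ρ := fun ρ hρ => by
    rw [Set.uIcc_of_le h1] at hρ
    have hd : HasDerivAt f (deriv f (ρ * u)) (ρ * u) :=
      (hf.differentiableAt (isOpen_ball.mem_nhds (hmem ρ hρ))).hasDerivAt
    have hl : HasDerivAt (fun ρ : ℝ => (ρ * u : ℂ)) (1 * u) ρ :=
      (Complex.ofRealCLM.hasDerivAt).mul_const u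
    rw [one_mul] at hl
    exact hd.comp ρ hl
  have hcont : ContinuousOn (fun ρ : ℝ => deriv f (ρ * u) * u) (Set.Icc r₀ r) := by
    refine ContinuousOn.mul ?_ continuousOn_const
    exact (hf.deriv isOpen_ball).continuousOn.comp (by fun_prop) hmem
  have hint : IntervalIntegrable (fun ρ : ℝ => deriv f (ρ * u) * u) volume r₀ r :=
    ContinuousOn.intervalIntegrable (by rwa [Set.uIcc_of_le h1])
  rw [← intervalIntegral.integral_eq_sub_of_hasDerivAt hder hint,
    intervalIntegral.integral_of_le h1, integral_Ioc_eq_integral_Ioo]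
  refine (enorm_integral_le_lintegral_enorm _).trans_eq (lintegral_congr fun ρ => ?_)
  rw [enorm_mul, ← ofReal_norm u, hu, ENNReal.ofReal_one, mul_one]

theorem setLIntegral_inv_one_sub {r : ℝ} (h0 : 0 ≤ r) (h1 : r < 1) :
    ∫⁻ ρ in Set.Ioo 0 r, ENNReal.ofReal (1 - ρ)⁻¹ = ENNReal.ofReal (Real.log (1 / (1 - r))) := by
  rw [← setLIntegral_inv_Ioo_one (by linarith) (by linarith),
    ← setLIntegral_one_sub (fun x => ENNReal.ofReal x⁻¹), sub_self, sub_sub_cancel]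

/-- Functions in `F(p, p - 2, t)` grow at most logarithmically. -/
theorem enorm_le_log_mul_fNorm {p t : ℝ} (hp : 1 < p) (ht : 0 < t) {f : ℂ → ℂ}
    (hf : DifferentiableOn ℂ f (ball 0 1)) {u : ℂ} (hu : ‖u‖ = 1) {r : ℝ} (h0 : 0 ≤ r)
    (h1 : r < 1) :
    ‖f (r * u)‖ₑ ≤ ENNReal.ofReal ((1 / Real.log 2 + blochConst p t) * Real.log (2 / (1 - r))) *
      fNorm p (p - 2) t f := by
  have hl2 : 0 < Real.log 2 := Real.log_pos (by norm_num)
  set N := fNorm p (p - 2) t f with hN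
  have hx : 0 < 1 - r := by linarith
  have hlog : Real.log (2 / (1 - r)) = Real.log 2 + Real.log (1 / (1 - r)) := by
    rw [← Real.log_mul (by norm_num) (by positivity)]
    congr 1; ring
  have hlog0 : 0 ≤ Real.log (1 / (1 - r)) :=
    Real.log_nonneg (by rw [le_div_iff₀ hx]; linarith)
  have hB := blochConst_nonneg p t
  have hd : ‖f (r * u) - f 0‖ₑ ≤
      ENNReal.ofReal (blochConst p t * Real.log (1 / (1 - r))) * N := by
    have h := enorm_sub_le_lintegral_radial hf hu le_rfl h0 h1
    rw [Complex.ofReal_zero, zero_mul] at h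
    refine h.trans ?_
    calc ∫⁻ ρ in Set.Ioo 0 r, ‖deriv f (ρ * u)‖ₑ
        ≤ ∫⁻ ρ in Set.Ioo 0 r,
            ENNReal.ofReal (blochConst p t) * N * ENNReal.ofReal (1 - ρ)⁻¹ := by
          refine setLIntegral_mono' measurableSet_Ioo fun ρ hρ => ?_
          have hn : ‖(ρ * u : ℂ)‖ = ρ := by
            rw [norm_mul, hu, mul_one, Complex.norm_real, Real.norm_of_nonneg hρ.1.le]
          have := enorm_deriv_le_fNorm hp ht hf (w := ρ * u)
            (by rw [mem_ball, dist_zero_right, hn]; exact hρ.2.trans h1)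
          rwa [hn] at this
      _ = ENNReal.ofReal (blochConst p t) * N * ENNReal.ofReal (Real.log (1 / (1 - r))) := by
          rw [lintegral_const_mul _ (by fun_prop), setLIntegral_inv_one_sub h0 h1]
      _ = _ := by
          rw [ENNReal.ofReal_mul hB]; ring
  have hf0 : ‖f 0‖ₑ ≤ N := le_self_add
  calc ‖f (r * u)‖ₑ = ‖f 0 + (f (r * u) - f 0)‖ₑ := by rw [add_sub_cancel]
    _ ≤ ‖f 0‖ₑ + ‖f (r * u) - f 0‖ₑ := enorm_add_le _ _
    _ ≤ ENNReal.ofReal 1 * N + ENNReal.ofReal (blochConst p t * Real.log (1 / (1 - r))) * N := by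
        rw [ENNReal.ofReal_one, one_mul]
        exact add_le_add hf0 hd
    _ = ENNReal.ofReal (1 + blochConst p t * Real.log (1 / (1 - r))) * N := by
        rw [ENNReal.ofReal_add zero_le_one (by positivity), add_mul]
    _ ≤ _ := by
        gcongr
        -- The coefficient `1 / log 2` absorbs the contribution of `f 0`, because `log (2 / (1 - r))
        -- ≥ log 2`.
        rw [hlog, add_mul, mul_add, mul_add, one_div_mul_cancel hl2.ne']
        have : 0 ≤ 1 / Real.log 2 * Real.log (1 / (1 - r)) := by positivity
        have : 0 ≤ blochConst p t * Real.log 2 := by positivity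
        linarith

/-- Hölder's inequality for radial increments. -/
theorem enorm_sub_rpow_le_lintegral_radial {p ε : ℝ} (hp : 1 < p) (hε : 0 < ε) {f : ℂ → ℂ}
    (hf : DifferentiableOn ℂ f (ball 0 1)) {u : ℂ} (hu : ‖u‖ = 1) {ℓ r : ℝ} (hℓ : 0 < ℓ)
    (hℓ1 : ℓ ≤ 1) (h1 : 1 - ℓ ≤ r) (h2 : r < 1) :
    ‖f (r * u) - f ((1 - ℓ : ℝ) * u)‖ₑ ^ p ≤
      ENNReal.ofReal (((p - 1) / ε) ^ (p - 1) * ℓ ^ ε) *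
        ∫⁻ ρ in Set.Ioo (1 - ℓ) r, ‖deriv f (ρ * u)‖ₑ ^ p *
          ENNReal.ofReal ((1 - ρ) ^ (p - 1 - ε)) := by
  have hp0 : 0 < p := by linarith
  have hp1 : 0 < p - 1 := by linarith
  -- With this `κ`, the conjugate exponent turns `(1 - ρ) ^ (-κ)` into `(1 - ρ) ^ (ε / (p - 1) -
  -- 1)`, which is integrable up to `1` exactly because `ε > 0`.
  set κ := (p - 1 - ε) / p with hκ
  have hmeas : Measurable fun ρ : ℝ => ‖deriv f (ρ * u)‖ₑ :=
    ((measurable_deriv f).comp (by fun_prop)).enorm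
  have hH := lintegral_mul_rpow_le (volume.restrict (Set.Ioo (1 - ℓ) r)) hp
    (u := fun ρ => ‖deriv f (ρ * u)‖ₑ * ENNReal.ofReal ((1 - ρ) ^ κ))
    (v := fun ρ => ENNReal.ofReal ((1 - ρ) ^ (-κ)))
    (hmeas.mul (by fun_prop)).aemeasurable (by fun_prop)
  have hI : ∫⁻ ρ in Set.Ioo (1 - ℓ) r, ‖deriv f (ρ * u)‖ₑ =
      ∫⁻ ρ in Set.Ioo (1 - ℓ) r, ‖deriv f (ρ * u)‖ₑ * ENNReal.ofReal ((1 - ρ) ^ κ) *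
        ENNReal.ofReal ((1 - ρ) ^ (-κ)) := by
    refine setLIntegral_congr_fun measurableSet_Ioo fun ρ hρ => ?_
    have hρ' : 0 < 1 - ρ := by linarith [hρ.2]
    rw [mul_assoc, ← ENNReal.ofReal_mul (by positivity), ← Real.rpow_add hρ', add_neg_cancel,
      Real.rpow_zero, ENNReal.ofReal_one, mul_one]
  have hv : (∫⁻ ρ in Set.Ioo (1 - ℓ) r, ENNReal.ofReal ((1 - ρ) ^ (-κ)) ^ (p / (p - 1))) ^ (p - 1)
      ≤ ENNReal.ofReal (((p - 1) / ε) ^ (p - 1) * ℓ ^ ε) := by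
    have hb : ∫⁻ ρ in Set.Ioo (1 - ℓ) r, ENNReal.ofReal ((1 - ρ) ^ (-κ)) ^ (p / (p - 1)) ≤
        ENNReal.ofReal (ℓ ^ (ε / (p - 1)) / (ε / (p - 1))) := by
      rw [← setLIntegral_rpow_Ioo_zero hℓ.le (by positivity),
        ← setLIntegral_one_sub (fun x => ENNReal.ofReal (x ^ (ε / (p - 1) - 1))), sub_zero]
      refine (lintegral_mono_set (Set.Ioo_subset_Ioo_right h2.le)).trans
        (setLIntegral_mono' measurableSet_Ioo fun ρ hρ => ?_)
      have hρ' : 0 < 1 - ρ := by linarith [hρ.2]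
      rw [ENNReal.ofReal_rpow_of_pos (by positivity), ← Real.rpow_mul hρ'.le]
      apply le_of_eq
      congr 2
      rw [hκ]
      field_simp
      ring
    calc _ ≤ (ENNReal.ofReal (ℓ ^ (ε / (p - 1)) / (ε / (p - 1)))) ^ (p - 1) := by gcongr
      _ = _ := by
        rw [ENNReal.ofReal_rpow_of_pos (by positivity)]
        congr 1
        rw [Real.div_rpow (by positivity) (by positivity), ← Real.rpow_mul hℓ.le,
          div_mul_cancel₀ _ hp1.ne', div_eq_mul_inv, mul_comm, ← Real.inv_rpow (by positivity),
          inv_div]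
  have hu' : ∫⁻ ρ in Set.Ioo (1 - ℓ) r,
      (‖deriv f (ρ * u)‖ₑ * ENNReal.ofReal ((1 - ρ) ^ κ)) ^ p =
      ∫⁻ ρ in Set.Ioo (1 - ℓ) r, ‖deriv f (ρ * u)‖ₑ ^ p *
          ENNReal.ofReal ((1 - ρ) ^ (p - 1 - ε)) := by
    refine setLIntegral_congr_fun measurableSet_Ioo fun ρ hρ => ?_
    have hρ' : 0 < 1 - ρ := by linarith [hρ.2]
    rw [ENNReal.mul_rpow_of_nonneg _ _ hp0.le, ENNReal.ofReal_rpow_of_pos (by positivity),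
      ← Real.rpow_mul hρ'.le, hκ, div_mul_cancel₀ _ hp0.ne']
  calc ‖f (r * u) - f ((1 - ℓ : ℝ) * u)‖ₑ ^ p
      ≤ (∫⁻ ρ in Set.Ioo (1 - ℓ) r, ‖deriv f (ρ * u)‖ₑ) ^ p := by
        gcongr
        exact enorm_sub_le_lintegral_radial hf hu (by linarith) h1 h2
    _ ≤ _ := by
        rw [hI]
        refine hH.trans ?_
        rw [hu', mul_comm]
        gcongr

/-! ### Geometry of arcs, tents and windows -/

/-- The angle is `θ` plus the principal argument of `u / exp (iθ)`; an arc of angle at most `π` is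
at most `π / 2` times its chord. -/
theorem exists_angle_near {u : ℂ} (hu : ‖u‖ = 1) (θ : ℝ) :
    ∃ x : ℝ, u = Complex.exp (x * Complex.I) ∧ |x - θ| ≤ Real.pi ∧
      |x - θ| ≤ Real.pi / 2 * ‖u - Complex.exp (θ * Complex.I)‖ := by
  set e := Complex.exp (θ * Complex.I) with he
  have hen : ‖e‖ = 1 := Complex.norm_exp_ofReal_mul_I θ
  have he0 : e ≠ 0 := Complex.exp_ne_zero _
  set v := u / e with hv
  have hvn : ‖v‖ = 1 := by rw [hv, norm_div, hu, hen, div_one]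
  have hv0 : v ≠ 0 := norm_pos_iff.1 (by rw [hvn]; exact one_pos)
  refine ⟨θ + v.arg, ?_, ?_, ?_⟩
  · have h := Complex.norm_mul_exp_arg_mul_I v
    rw [hvn, Complex.ofReal_one, one_mul] at h
    push_cast
    rw [add_mul, Complex.exp_add, h, ← he, hv, mul_div_cancel₀ _ he0]
  · rw [add_sub_cancel_left]
    exact Complex.abs_arg_le_pi v
  · rw [add_sub_cancel_left, ← Complex.angle_one_right hv0]
    refine (Complex.angle_le_mul_norm_sub hvn norm_one).trans_eq ?_
    congr 1
    rw [hv, div_sub_one he0, norm_div, hen, div_one]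

theorem mem_arc_of_norm_sub_le {u : ℂ} (hu : ‖u‖ = 1) {θ ℓ : ℝ}
    (h : ‖u - Complex.exp (θ * Complex.I)‖ ≤ 2 * ℓ) : u ∈ arc θ ℓ := by
  obtain ⟨x, hx, -, h2⟩ := exists_angle_near hu θ
  refine ⟨x, h2.trans ?_, hx⟩
  nlinarith [Real.pi_pos]

theorem mem_arc_one {u : ℂ} (hu : ‖u‖ = 1) (θ : ℝ) : u ∈ arc θ 1 := by
  obtain ⟨x, hx, h1, -⟩ := exists_angle_near hu θ
  exact ⟨x, by linarith, hx⟩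

theorem norm_sub_le_of_mem_arc {u : ℂ} {θ ℓ : ℝ} (h : u ∈ arc θ ℓ) :
    ‖u - Complex.exp (θ * Complex.I)‖ ≤ Real.pi * ℓ := by
  obtain ⟨x, hx, rfl⟩ := h
  have e : Complex.exp (x * Complex.I) - Complex.exp (θ * Complex.I) =
      Complex.exp (θ * Complex.I) * (Complex.exp (Complex.I * (x - θ : ℝ)) - 1) := by
    rw [mul_sub, ← Complex.exp_add, mul_one]
    congr 2
    push_cast
    ring
  rw [e, norm_mul, Complex.norm_exp_ofReal_mul_I, one_mul]
  exact (Real.norm_exp_I_mul_ofReal_sub_one_le).trans hx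

theorem isClosed_arc (θ ℓ : ℝ) : IsClosed (arc θ ℓ) := by
  have e : arc θ ℓ = (fun x : ℝ => Complex.exp (x * Complex.I)) ''
      (closedBall θ (Real.pi * ℓ)) := by
    ext w
    simp only [arc, Set.mem_ofPred_eq, Set.mem_image, mem_closedBall, Real.dist_eq]
    exact ⟨fun ⟨x, h, e⟩ => ⟨x, h, e.symm⟩, fun ⟨x, h, e⟩ => ⟨x, h, e.symm⟩⟩
  rw [e]
  exact ((isCompact_closedBall θ _).image (by fun_prop)).isClosed

theorem measurableSet_tent (θ ℓ : ℝ) : MeasurableSet (tent θ ℓ) := by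
  refine (measurableSet_lt measurable_const measurable_norm).inter
    ((measurableSet_lt measurable_norm measurable_const).inter ?_)
  have hm : Measurable fun z : ℂ => z / (‖z‖ : ℂ) := by fun_prop
  exact hm (isClosed_arc θ ℓ).measurableSet

theorem norm_div_norm_of_mem_tent {θ ℓ : ℝ} (hℓ : ℓ ≤ 1) {z : ℂ} (hz : z ∈ tent θ ℓ) :
    ‖z / (‖z‖ : ℂ)‖ = 1 := by
  have : ‖z‖ ≠ 0 := by linarith [hz.1]
  rw [norm_div, Complex.norm_real, norm_norm, div_self this]

theorem measure_tent_le (s : ℝ) (μ : Measure ℂ) {θ ℓ : ℝ} (hℓ : 0 < ℓ) (hℓ1 : ℓ ≤ 1) :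
    μ (tent θ ℓ) ≤ carlesonNorm s μ * ENNReal.ofReal (ℓ ^ s) := by
  have h : μ (tent θ ℓ) / ENNReal.ofReal (ℓ ^ s) ≤ carlesonNorm s μ :=
    (le_iSup₂ (f := fun (ℓ : ℝ) (_ : ℓ ∈ Set.Ioc (0 : ℝ) 1) =>
      μ (tent θ ℓ) / ENNReal.ofReal (ℓ ^ s)) ℓ ⟨hℓ, hℓ1⟩).trans
      (le_iSup (fun θ : ℝ => ⨆ (ℓ ∈ Set.Ioc (0 : ℝ) 1), μ (tent θ ℓ) / ENNReal.ofReal (ℓ ^ s)) θ)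
  have h0 : ENNReal.ofReal (ℓ ^ s) ≠ 0 := by
    rw [Ne, ENNReal.ofReal_eq_zero, not_le]
    positivity
  exact (ENNReal.div_le_iff h0 ENNReal.ofReal_ne_top).1 h

/-- A point whose radius passes near `ζ` lies in a tent of size comparable to `1 - ‖ζ‖`. -/
theorem mem_tent_arg {z ζ : ℂ} {ρ : ℝ} (h0 : 0 ≤ ρ) (h1 : ρ < ‖z‖) (h2 : ‖z‖ < 1)
    (h : ‖ρ * (z / (‖z‖ : ℂ)) - ζ‖ < (1 - ρ) / 2) :
    1 - 2 * (1 - ‖ζ‖) < ρ ∧ z ∈ tent ζ.arg (min (2 * (1 - ‖ζ‖)) 1) := by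
  have hz0 : 0 < ‖z‖ := h0.trans_lt h1
  set u := z / (‖z‖ : ℂ) with hudef
  have hu : ‖u‖ = 1 := by
    rw [hudef, norm_div, Complex.norm_real, norm_norm, div_self hz0.ne']
  have hρu : ‖(ρ * u : ℂ)‖ = ρ := by
    rw [norm_mul, hu, mul_one, Complex.norm_real, Real.norm_of_nonneg h0]
  have hd : (1 - ρ) / 2 < 1 - ‖ζ‖ := by
    have := norm_sub_norm_le ζ (ρ * u)
    rw [norm_sub_rev, hρu] at this
    linarith
  refine ⟨by linarith, lt_of_le_of_lt (sub_le_sub_left (le_refl _) _) ?_, h2, ?_⟩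
  · rcases min_cases (2 * (1 - ‖ζ‖)) 1 with h' | h' <;> rw [h'.1] <;> linarith
  · rcases le_total (2 * (1 - ‖ζ‖)) 1 with h' | h'
    · rw [min_eq_left h']
      apply mem_arc_of_norm_sub_le hu
      have hζ : ‖ζ - Complex.exp (ζ.arg * Complex.I)‖ = 1 - ‖ζ‖ := by
        nth_rewrite 1 [← Complex.norm_mul_exp_arg_mul_I ζ]
        rw [← sub_one_mul, norm_mul, Complex.norm_exp_ofReal_mul_I, mul_one,
          ← Complex.ofReal_one, ← Complex.ofReal_sub, Complex.norm_real, norm_sub_rev,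
          Real.norm_of_nonneg (by linarith)]
      have hu2 : ‖u - ρ * u‖ = 1 - ρ := by
        rw [← one_sub_mul, norm_mul, hu, mul_one, ← Complex.ofReal_one, ← Complex.ofReal_sub,
          Complex.norm_real, Real.norm_of_nonneg (by linarith)]
      -- With `δ = 1 - ‖ζ‖` and `1 - ρ < 2 * δ`, the three legs are at most `2 * δ`, `δ` and `δ`.
      -- The total `4 * δ` is twice the arc length `2 * δ`, as `mem_arc_of_norm_sub_le` requires.
      have e : u - Complex.exp (ζ.arg * Complex.I) =
          (u - ρ * u) + (ρ * u - ζ) + (ζ - Complex.exp (ζ.arg * Complex.I)) := by ring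
      rw [e]
      refine (norm_add₃_le).trans ?_
      rw [hζ, hu2]
      linarith
    · rw [min_eq_right h']
      exact mem_arc_one hu _

/-- The hyperbolic centre of a tent. -/
noncomputable def tentCenter (θ ℓ : ℝ) : ℂ := (1 - ℓ : ℝ) * Complex.exp (θ * Complex.I)

theorem norm_tentCenter {ℓ : ℝ} (θ : ℝ) (hℓ : ℓ ≤ 1) : ‖tentCenter θ ℓ‖ = 1 - ℓ := by
  rw [tentCenter, norm_mul, Complex.norm_exp_ofReal_mul_I, mul_one, Complex.norm_real,
    Real.norm_of_nonneg (by linarith)]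

theorem norm_one_sub_conj_tentCenter_mul_le {θ ℓ : ℝ} (hℓ : 0 < ℓ) (hℓ1 : ℓ ≤ 1) (ζ : ℂ) :
    ‖1 - conj (tentCenter θ ℓ) * ζ‖ ≤ ℓ + ‖Complex.exp (θ * Complex.I) - ζ‖ := by
  have h1 : conj (Complex.exp (θ * Complex.I)) * Complex.exp (θ * Complex.I) = 1 := by
    rw [Complex.conj_mul', Complex.norm_exp_ofReal_mul_I]
    simp
  have e : 1 - conj (tentCenter θ ℓ) * ζ =
      (ℓ : ℂ) + conj (tentCenter θ ℓ) * (Complex.exp (θ * Complex.I) - ζ) := by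
    rw [tentCenter, map_mul, Complex.conj_ofReal, mul_sub,
      mul_assoc _ _ (Complex.exp (θ * Complex.I)), h1]
    push_cast
    ring
  rw [e]
  refine (norm_add_le _ _).trans ?_
  rw [norm_mul, RCLike.norm_conj, norm_tentCenter θ hℓ1, Complex.norm_real,
    Real.norm_of_nonneg hℓ.le]
  nlinarith [norm_nonneg (Complex.exp (θ * Complex.I) - ζ)]

theorem norm_one_sub_conj_tentCenter_mul_le_of_near {θ ℓ ρ : ℝ} (hℓ : 0 < ℓ) (hℓ1 : ℓ ≤ 1)
    {z ζ : ℂ} (hz : z ∈ tent θ ℓ) (h1 : 1 - ℓ < ρ) (h2 : ρ < 1)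
    (h : ‖ρ * (z / (‖z‖ : ℂ)) - ζ‖ < (1 - ρ) / 2) :
    ‖1 - conj (tentCenter θ ℓ) * ζ‖ ≤ 6 * ℓ := by
  have hu := norm_div_norm_of_mem_tent hℓ1 hz
  have harc := norm_sub_le_of_mem_arc hz.2.2
  set u := z / (‖z‖ : ℂ) with hudef
  have hu2 : ‖u - ρ * u‖ = 1 - ρ := by
    rw [← one_sub_mul, norm_mul, hu, mul_one, ← Complex.ofReal_one, ← Complex.ofReal_sub,
      Complex.norm_real, Real.norm_of_nonneg (by linarith)]
  have e : Complex.exp (θ * Complex.I) - ζ =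
      (Complex.exp (θ * Complex.I) - u) + (u - ρ * u) + (ρ * u - ζ) := by ring
  have h3 : ‖Complex.exp (θ * Complex.I) - ζ‖ ≤ Real.pi * ℓ + (1 - ρ) + (1 - ρ) / 2 := by
    rw [e]
    refine (norm_add₃_le).trans ?_
    rw [norm_sub_rev, hu2]
    linarith
  -- The sum is at most `(1 + π + 3 / 2) * ℓ`, which is below `6 * ℓ`.
  refine (norm_one_sub_conj_tentCenter_mul_le hℓ hℓ1 ζ).trans ?_
  nlinarith [Real.pi_lt_d2]

/-- Points of the disc in the Carleson window around the centre of a tent. -/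
def window (θ ℓ : ℝ) : Set ℂ := {ζ | ζ ∈ ball (0 : ℂ) 1 ∧ ‖1 - conj (tentCenter θ ℓ) * ζ‖ ≤ 6 * ℓ}

theorem measurableSet_window (θ ℓ : ℝ) : MeasurableSet (window θ ℓ) :=
  measurableSet_ball.inter (measurableSet_le
    (f := fun ζ : ℂ => ‖1 - conj (tentCenter θ ℓ) * ζ‖) (by fun_prop) measurable_const)

/-! ### From tent integrals to area integrals -/

/-- Sub-mean value property on a disc of area `π / 4 * (1 - ‖w‖) ^ 2`: dividing by the area lowers
the exponent by two, and the weight is comparable to a constant on the disc. -/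
theorem deriv_rpow_mul_le_lintegral {p ε : ℝ} (hp : 1 < p) {f : ℂ → ℂ}
    (hf : DifferentiableOn ℂ f (ball 0 1)) {w : ℂ} (hw : ‖w‖ < 1) :
    ‖deriv f w‖ₑ ^ p * ENNReal.ofReal ((1 - ‖w‖) ^ (p - 1 - ε)) ≤
      ENNReal.ofReal (4 / Real.pi * 3 ^ |p - 3 - ε|) *
        ∫⁻ ζ in ball w ((1 - ‖w‖) / 2), ‖deriv f ζ‖ₑ ^ p *
          ENNReal.ofReal ((1 - ‖ζ‖ ^ 2) ^ (p - 3 - ε)) := by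
  set x := 1 - ‖w‖ with hx
  have hx0 : 0 < x := by linarith
  have hpi := Real.pi_pos
  have hsub : ball w (x / 2) ⊆ ball 0 1 := fun z hz => by
    have := (norm_bounds_of_mem_ball_half hz).1
    simp only [mem_ball, dist_zero_right]
    linarith
  have hdf : DifferentiableOn ℂ (deriv f) (ball w (x / 2)) :=
    (hf.deriv isOpen_ball).mono hsub
  have h1 := enorm_rpow_center_le_lintegral_ball (measurable_deriv f) hp (half_pos hx0) hdf
  have hvol : volume (ball w (x / 2)) = ENNReal.ofReal (Real.pi / 4 * x ^ 2) := by
    rw [Complex.volume_ball, ← ENNReal.ofReal_pow (by positivity),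
      show ((NNReal.pi : ℝ≥0) : ℝ≥0∞) = ENNReal.ofReal Real.pi by
        rw [← NNReal.coe_real_pi, ENNReal.ofReal_coe_nnreal], ← ENNReal.ofReal_mul (by positivity)]
    congr 1
    ring
  rw [hvol] at h1
  have e : ENNReal.ofReal (x ^ (p - 1 - ε)) = ENNReal.ofReal (4 / Real.pi) *
      ENNReal.ofReal (x ^ (p - 3 - ε)) * ENNReal.ofReal (Real.pi / 4 * x ^ 2) := by
    rw [← ENNReal.ofReal_mul (by positivity), ← ENNReal.ofReal_mul (by positivity)]
    congr 1
    rw [show p - 1 - ε = (p - 3 - ε) + (2 : ℕ) by push_cast; ring, Real.rpow_add_natCast hx0.ne']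
    field_simp
  calc ‖deriv f w‖ₑ ^ p * ENNReal.ofReal (x ^ (p - 1 - ε))
      = ENNReal.ofReal (4 / Real.pi) * (ENNReal.ofReal (x ^ (p - 3 - ε)) *
          (‖deriv f w‖ₑ ^ p * ENNReal.ofReal (Real.pi / 4 * x ^ 2))) := by rw [e]; ring
    _ ≤ ENNReal.ofReal (4 / Real.pi) * (ENNReal.ofReal (x ^ (p - 3 - ε)) *
          ∫⁻ ζ in ball w (x / 2), ‖deriv f ζ‖ₑ ^ p) := by gcongr
    _ = ENNReal.ofReal (4 / Real.pi) *
          ∫⁻ ζ in ball w (x / 2), ENNReal.ofReal (x ^ (p - 3 - ε)) * ‖deriv f ζ‖ₑ ^ p := by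
        rw [lintegral_const_mul' _ _ ENNReal.ofReal_ne_top]
    _ ≤ ENNReal.ofReal (4 / Real.pi) *
          ∫⁻ ζ in ball w (x / 2), ENNReal.ofReal (3 ^ |p - 3 - ε|) * (‖deriv f ζ‖ₑ ^ p *
            ENNReal.ofReal ((1 - ‖ζ‖ ^ 2) ^ (p - 3 - ε))) := by
        gcongr 1
        refine setLIntegral_mono' measurableSet_ball fun ζ hζ => ?_
        rw [mul_left_comm, mul_comm (ENNReal.ofReal (x ^ (p - 3 - ε))),
          ← ENNReal.ofReal_mul (by positivity)]
        gcongr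
        have hb := norm_bounds_of_mem_ball_half hζ
        have hn := norm_nonneg ζ
        have hy1 : x / 2 ≤ 1 - ‖ζ‖ ^ 2 := by nlinarith [hb.1]
        exact rpow_le_mul_rpow_of_comparable _ (by linarith) (by norm_num)
          (by nlinarith [hb.2]) (by linarith)
    _ = _ := by
        rw [lintegral_const_mul' _ _ ENNReal.ofReal_ne_top, ← mul_assoc,
          ← ENNReal.ofReal_mul (by positivity)]

/-- The weighted radial integrals of `f'` integrate over a tent to an area integral over the
corresponding window. -/
theorem lintegral_tent_radial_le {p s ε : ℝ} (hp : 1 < p) (hs : 0 < s) {μ : Measure ℂ}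
    (hμ : IsCarleson s μ) {f : ℂ → ℂ} (hf : DifferentiableOn ℂ f (ball 0 1)) {θ ℓ : ℝ}
    (hℓ : 0 < ℓ) (hℓ1 : ℓ ≤ 1) :
    ∫⁻ z in tent θ ℓ, (∫⁻ ρ in Set.Ioo (1 - ℓ) ‖z‖, ‖deriv f (ρ * (z / (‖z‖ : ℂ)))‖ₑ ^ p *
        ENNReal.ofReal ((1 - ρ) ^ (p - 1 - ε))) ∂μ ≤
      ENNReal.ofReal (4 / Real.pi * 3 ^ |p - 3 - ε|) * (carlesonNorm s μ *
        ∫⁻ ζ in window θ ℓ, ‖deriv f ζ‖ₑ ^ p *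
          ENNReal.ofReal ((1 - ‖ζ‖ ^ 2) ^ (p - 3 - ε) * (2 * (1 - ‖ζ‖)) ^ (s + 1))) := by
  set H : ℂ → ℝ≥0∞ := fun ζ => ‖deriv f ζ‖ₑ ^ p *
    ENNReal.ofReal ((1 - ‖ζ‖ ^ 2) ^ (p - 3 - ε)) with hH
  have hHm : Measurable H := by
    refine Measurable.mul ((measurable_deriv f).enorm.pow_const p) ?_
    fun_prop
  set C₀ := ENNReal.ofReal (4 / Real.pi * 3 ^ |p - 3 - ε|) with hC₀
  -- `μ` itself need not be σ-finite; the Carleson bound makes its restriction to the tent finite,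
  -- so the product measure and Tonelli are available.
  have hfin : IsFiniteMeasure (μ.restrict (tent θ ℓ)) := by
    constructor
    rw [Measure.restrict_apply_univ]
    exact (measure_tent_le s μ hℓ hℓ1).trans_lt (ENNReal.mul_lt_top hμ ENNReal.ofReal_lt_top)
  -- The incidence relation for Tonelli: `ζ` lies in the averaging disc about the point of radius
  -- `ρ` on the ray through `z`.
  set A : Set ((ℂ × ℝ) × ℂ) := {q | q.1.2 < ‖q.1.1‖ ∧
    ‖q.1.2 * (q.1.1 / (‖q.1.1‖ : ℂ)) - q.2‖ < (1 - q.1.2) / 2} with hA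
  have hAm : MeasurableSet A := by
    have h₁ : Measurable fun q : (ℂ × ℝ) × ℂ => q.1.2 := by fun_prop
    have h₂ : Measurable fun q : (ℂ × ℝ) × ℂ => ‖q.1.1‖ := by fun_prop
    have h₃ : Measurable fun q : (ℂ × ℝ) × ℂ =>
        ‖q.1.2 * (q.1.1 / (‖q.1.1‖ : ℂ)) - q.2‖ := by fun_prop
    have h₄ : Measurable fun q : (ℂ × ℝ) × ℂ => (1 - q.1.2) / 2 := by fun_prop
    exact (measurableSet_lt h₁ h₂).inter (measurableSet_lt h₃ h₄)
  set Φ : (ℂ × ℝ) × ℂ → ℝ≥0∞ := A.indicator fun q => H q.2 with hΦ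
  have hΦm : Measurable Φ := (hHm.comp measurable_snd).indicator hAm
  set ν := μ.restrict (tent θ ℓ) with hν
  set lam := (volume : Measure ℝ).restrict (Set.Ioo (1 - ℓ) 1) with hlam
  have hpt : ∀ z ∈ tent θ ℓ, (∫⁻ ρ in Set.Ioo (1 - ℓ) ‖z‖,
      ‖deriv f (ρ * (z / (‖z‖ : ℂ)))‖ₑ ^ p * ENNReal.ofReal ((1 - ρ) ^ (p - 1 - ε))) ≤
      C₀ * ∫⁻ ρ, (∫⁻ ζ in ball (0 : ℂ) 1, Φ ((z, ρ), ζ)) ∂lam := by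
    intro z hz
    rw [← lintegral_const_mul' _ _ ENNReal.ofReal_ne_top]
    calc _ ≤ ∫⁻ ρ in Set.Ioo (1 - ℓ) ‖z‖, C₀ * ∫⁻ ζ in ball (0 : ℂ) 1, Φ ((z, ρ), ζ) := by
          refine setLIntegral_mono' measurableSet_Ioo fun ρ hρ => ?_
          have hρ0 : 0 ≤ ρ := by linarith [hρ.1]
          have hn : ‖(ρ * (z / (‖z‖ : ℂ)) : ℂ)‖ = ρ := by
            rw [norm_mul, norm_div_norm_of_mem_tent hℓ1 hz, mul_one, Complex.norm_real,
              Real.norm_of_nonneg hρ0]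
          have h := deriv_rpow_mul_le_lintegral (ε := ε) hp hf
            (w := ρ * (z / (‖z‖ : ℂ))) (by rw [hn]; exact hρ.2.trans hz.2.1)
          have hsub : ball (ρ * (z / (‖z‖ : ℂ)) : ℂ) ((1 - ρ) / 2) ⊆ ball 0 1 := fun ζ hζ => by
            have := (norm_bounds_of_mem_ball_half (w := ρ * (z / (‖z‖ : ℂ))) (z := ζ)
              (by rwa [hn])).1
            rw [hn] at this
            simp only [mem_ball, dist_zero_right]
            linarith [hρ.2, hz.2.1]
          rw [hn] at h
          refine h.trans ?_
          gcongr 1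
          calc _ = ∫⁻ ζ in ball (ρ * (z / (‖z‖ : ℂ)) : ℂ) ((1 - ρ) / 2), Φ ((z, ρ), ζ) := by
                refine setLIntegral_congr_fun measurableSet_ball fun ζ hζ => ?_
                rw [mem_ball, dist_eq_norm, norm_sub_rev] at hζ
                rw [hΦ, Set.indicator_of_mem (show ((z, ρ), ζ) ∈ A from ⟨hρ.2, hζ⟩)]
            _ ≤ _ := lintegral_mono_set hsub
      _ ≤ _ := lintegral_mono_set (Set.Ioo_subset_Ioo_right hz.2.1.le)
  -- The slice of `A` at `ζ` is empty off the window. Otherwise it sits in the product of a tent and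
  -- an interval, both of size about `1 - ‖ζ‖`; these give the powers `s` and `1`.
  have hinner : ∀ ζ ∈ ball (0 : ℂ) 1, ∫⁻ q, Φ (q, ζ) ∂(ν.prod lam) ≤
      (window θ ℓ).indicator (fun ζ => carlesonNorm s μ * (H ζ *
        ENNReal.ofReal ((2 * (1 - ‖ζ‖)) ^ (s + 1)))) ζ := by
    intro ζ hζ
    have hζ1 : 0 < 1 - ‖ζ‖ := by simpa using hζ
    -- The Carleson norm only tests lengths up to `1`, hence the truncation.
    set m := min (2 * (1 - ‖ζ‖)) 1 with hm
    have hm0 : 0 < m := lt_min (by linarith) one_pos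
    rw [lintegral_prod (fun q => Φ (q, ζ)) (hΦm.comp measurable_prodMk_right).aemeasurable]
    by_cases hw : ζ ∈ window θ ℓ
    · rw [Set.indicator_of_mem hw]
      calc ∫⁻ z, ∫⁻ ρ, Φ ((z, ρ), ζ) ∂lam ∂ν
          ≤ ∫⁻ z, (tent ζ.arg m).indicator
              (fun _ => H ζ * ENNReal.ofReal (2 * (1 - ‖ζ‖))) z ∂ν := by
            refine setLIntegral_mono' (measurableSet_tent θ ℓ) fun z hz => ?_
            by_cases hzt : z ∈ tent ζ.arg m
            · rw [Set.indicator_of_mem hzt]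
              calc ∫⁻ ρ, Φ ((z, ρ), ζ) ∂lam
                  ≤ ∫⁻ ρ, (Set.Ioo (1 - 2 * (1 - ‖ζ‖)) 1).indicator (fun _ => H ζ) ρ ∂lam := by
                    refine setLIntegral_mono' measurableSet_Ioo fun ρ hρ => ?_
                    by_cases hq : ((z, ρ), ζ) ∈ A
                    · have := (mem_tent_arg (by linarith [hρ.1]) hq.1 hz.2.1 hq.2).1
                      rw [hΦ, Set.indicator_of_mem hq,
                        Set.indicator_of_mem (Set.mem_Ioo.2 ⟨this, hρ.2⟩)]
                    · rw [hΦ, Set.indicator_of_notMem hq]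
                      exact zero_le
                _ ≤ ∫⁻ ρ, (Set.Ioo (1 - 2 * (1 - ‖ζ‖)) 1).indicator (fun _ => H ζ) ρ :=
                    lintegral_mono' Measure.restrict_le_self le_rfl
                _ = H ζ * ENNReal.ofReal (2 * (1 - ‖ζ‖)) := by
                    rw [lintegral_indicator_const measurableSet_Ioo, Real.volume_Ioo,
                      sub_sub_cancel]
            · rw [Set.indicator_of_notMem hzt]
              refine le_of_eq ((setLIntegral_congr_fun measurableSet_Ioo fun ρ hρ => ?_).trans
                lintegral_zero)
              rw [hΦ, Set.indicator_of_notMem]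
              exact fun hq => hzt (mem_tent_arg (by linarith [hρ.1]) hq.1 hz.2.1 hq.2).2
        _ ≤ ∫⁻ z, (tent ζ.arg m).indicator
              (fun _ => H ζ * ENNReal.ofReal (2 * (1 - ‖ζ‖))) z ∂μ :=
            lintegral_mono' Measure.restrict_le_self le_rfl
        _ = H ζ * ENNReal.ofReal (2 * (1 - ‖ζ‖)) * μ (tent ζ.arg m) :=
            lintegral_indicator_const (measurableSet_tent _ _) _
        _ ≤ H ζ * ENNReal.ofReal (2 * (1 - ‖ζ‖)) *
              (carlesonNorm s μ * ENNReal.ofReal ((2 * (1 - ‖ζ‖)) ^ s)) := by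
            gcongr
            refine (measure_tent_le s μ hm0 (min_le_right _ _)).trans ?_
            gcongr
            exact min_le_left _ _
        _ = _ := by
            rw [Real.rpow_add_one (by positivity),
              ENNReal.ofReal_mul (p := (2 * (1 - ‖ζ‖)) ^ s) (by positivity)]
            ring
    · rw [Set.indicator_of_notMem hw]
      refine le_of_eq ((setLIntegral_congr_fun (measurableSet_tent θ ℓ) fun z hz => ?_).trans
        lintegral_zero)
      refine (setLIntegral_congr_fun measurableSet_Ioo fun ρ hρ => ?_).trans lintegral_zero
      rw [hΦ, Set.indicator_of_notMem]
      exact fun hq => hw ⟨hζ, norm_one_sub_conj_tentCenter_mul_le_of_near hℓ hℓ1 hz hρ.1 hρ.2 hq.2⟩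
  calc _ ≤ ∫⁻ z, C₀ * ∫⁻ ρ, (∫⁻ ζ in ball (0 : ℂ) 1, Φ ((z, ρ), ζ)) ∂lam ∂ν :=
        setLIntegral_mono' (measurableSet_tent θ ℓ) hpt
    _ = C₀ * ∫⁻ q, (∫⁻ ζ in ball (0 : ℂ) 1, Φ (q, ζ)) ∂(ν.prod lam) := by
        rw [lintegral_const_mul' _ _ ENNReal.ofReal_ne_top,
          lintegral_prod _ (Measurable.lintegral_prod_right' hΦm).aemeasurable]
    _ = C₀ * ∫⁻ ζ in ball (0 : ℂ) 1, ∫⁻ q, Φ (q, ζ) ∂(ν.prod lam) := by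
        rw [lintegral_lintegral_swap]
        exact hΦm.aemeasurable
    _ ≤ C₀ * ∫⁻ ζ in ball (0 : ℂ) 1, (window θ ℓ).indicator (fun ζ => carlesonNorm s μ * (H ζ *
          ENNReal.ofReal ((2 * (1 - ‖ζ‖)) ^ (s + 1)))) ζ := by
        gcongr 1
        exact setLIntegral_mono' measurableSet_ball hinner
    _ = C₀ * (carlesonNorm s μ * ∫⁻ ζ in window θ ℓ, H ζ *
          ENNReal.ofReal ((2 * (1 - ‖ζ‖)) ^ (s + 1))) := by
        rw [setLIntegral_indicator (measurableSet_window θ ℓ),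
          Set.inter_eq_left.2 (fun ζ hζ => hζ.1), lintegral_const_mul' _ _ (ne_of_lt hμ)]
    _ = _ := by
        congr 2
        refine setLIntegral_congr_fun (measurableSet_window θ ℓ) fun ζ hζ => ?_
        have hζ1 : ‖ζ‖ < 1 := by simpa using hζ.1
        have : 0 ≤ 1 - ‖ζ‖ ^ 2 := by nlinarith [norm_nonneg ζ]
        rw [hH, mul_assoc, ← ENNReal.ofReal_mul (by positivity)]

/-- On the window the denominator of `1 - ‖φ_a ζ‖ ^ 2` is at most `36 * ℓ ^ 2`, while `1 - ‖a‖ ^ 2 ≥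
ℓ`. This gives the lower bound `(1 - ‖ζ‖ ^ 2) / (36 * ℓ)`, whose `t`-th power trades the surplus `t`
powers of `1 - ‖ζ‖ ^ 2` for `ℓ ^ t`. -/
theorem lintegral_window_le {p s t : ℝ} (hp : 1 < p) (ht : 0 < t) (hs : 0 < s) (f : ℂ → ℂ)
    {θ ℓ : ℝ} (hℓ : 0 < ℓ) (hℓ1 : ℓ ≤ 1) :
    ∫⁻ ζ in window θ ℓ, ‖deriv f ζ‖ₑ ^ p *
      ENNReal.ofReal ((1 - ‖ζ‖ ^ 2) ^ (p - 3 - (s - t)) * (2 * (1 - ‖ζ‖)) ^ (s + 1)) ≤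
    ENNReal.ofReal (2 ^ (s + 1) * 36 ^ t * ℓ ^ t) * fNorm p (p - 2) t f ^ p := by
  have hc : ‖tentCenter θ ℓ‖ < 1 := by rw [norm_tentCenter θ hℓ1]; linarith
  refine setLIntegral_deriv_le_fNorm (by linarith) f (a := tentCenter θ ℓ) (by simpa using hc)
    (measurableSet_window θ ℓ) (fun ζ hζ => hζ.1) ENNReal.ofReal_ne_top fun ζ hζ => ?_
  rw [← ENNReal.ofReal_mul (by positivity)]
  apply ENNReal.ofReal_le_ofReal
  have hζ1 : ‖ζ‖ < 1 := by simpa using hζ.1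
  have hn := norm_nonneg ζ
  have hy : 0 < 1 - ‖ζ‖ ^ 2 := by nlinarith
  set y := 1 - ‖ζ‖ ^ 2 with hydef
  have hden := norm_one_sub_conj_mul_pos hc hζ1
  have hm : y / (36 * ℓ) ≤ 1 - ‖mobius (tentCenter θ ℓ) ζ‖ ^ 2 := by
    rw [one_sub_norm_mobius_sq (norm_pos_iff.1 hden), norm_tentCenter θ hℓ1,
      div_le_div_iff₀ (by positivity) (by positivity)]
    have h1 : ‖1 - conj (tentCenter θ ℓ) * ζ‖ ^ 2 ≤ (6 * ℓ) ^ 2 := by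
      gcongr
      exact hζ.2
    have h2 : ℓ ≤ 1 - (1 - ℓ) ^ 2 := by nlinarith
    calc y * ‖1 - conj (tentCenter θ ℓ) * ζ‖ ^ 2 ≤ y * (6 * ℓ) ^ 2 := by gcongr
      _ = ℓ * y * (36 * ℓ) := by ring
      _ ≤ _ := by gcongr
  have hd : 1 - ‖ζ‖ ≤ y := by nlinarith
  have hd0 : 0 < 1 - ‖ζ‖ := by linarith
  calc y ^ (p - 3 - (s - t)) * (2 * (1 - ‖ζ‖)) ^ (s + 1)
      ≤ y ^ (p - 3 - (s - t)) * (2 * y) ^ (s + 1) := by gcongr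
    _ = 2 ^ (s + 1) * y ^ (p - 2) * y ^ t := by
        rw [Real.mul_rpow (by norm_num) hy.le, mul_left_comm, ← Real.rpow_add hy, mul_assoc,
          ← Real.rpow_add hy]
        congr 2
        ring
    _ = 2 ^ (s + 1) * 36 ^ t * ℓ ^ t * (y ^ (p - 2) * (y / (36 * ℓ)) ^ t) := by
        rw [Real.div_rpow hy.le (by positivity), Real.mul_rpow (by norm_num) hℓ.le]
        field_simp
    _ ≤ _ := by gcongr

/-! ### The embedding for Carleson measures -/

/-- The constant in the embedding of `F(p, p - 2, t)` into the tent space. -/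
noncomputable def embeddingConst (p s t : ℝ) : ℝ :=
  2 ^ (p - 1) * ((1 / Real.log 2 + blochConst p t) ^ p +
    ((p - 1) / (s - t)) ^ (p - 1) * (4 / Real.pi * 3 ^ |p - 3 - (s - t)|) *
      (2 ^ (s + 1) * 36 ^ t) / Real.log 2 ^ p)

theorem lintegral_tent_enorm_rpow_le {p s t : ℝ} (hp : 1 < p) (ht : 0 < t) (hts : t < s)
    {μ : Measure ℂ} (hμ : IsCarleson s μ) {f : ℂ → ℂ} (hf : DifferentiableOn ℂ f (ball 0 1))
    {θ ℓ : ℝ} (hℓ : 0 < ℓ) (hℓ1 : ℓ ≤ 1) :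
    ∫⁻ z in tent θ ℓ, ‖f z‖ₑ ^ p ∂μ ≤
      ENNReal.ofReal (embeddingConst p s t) * carlesonNorm s μ * fNorm p (p - 2) t f ^ p *
        ENNReal.ofReal (ℓ ^ s * Real.log (2 / ℓ) ^ p) := by
  have hp0 : 0 < p := by linarith
  have hp1 : 0 < p - 1 := by linarith
  have hst : 0 < s - t := by linarith
  have hs : 0 < s := by linarith
  have hpi := Real.pi_pos
  have hl2 : 0 < Real.log 2 := Real.log_pos (by norm_num)
  set N := fNorm p (p - 2) t f with hN
  set K := carlesonNorm s μ with hK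
  set L := Real.log (2 / ℓ) with hL
  have hLl : Real.log 2 ≤ L :=
    Real.log_le_log (by norm_num) (by rw [le_div_iff₀ hℓ]; linarith)
  have hL0 : 0 < L := hl2.trans_le hLl
  set B := 1 / Real.log 2 + blochConst p t with hB
  have hB0 : 0 ≤ B := add_nonneg (by positivity) (blochConst_nonneg p t)
  set c₁ := ((p - 1) / (s - t)) ^ (p - 1) with hc₁
  have hc₁0 : 0 ≤ c₁ := by positivity
  set c₂ := 4 / Real.pi * 3 ^ |p - 3 - (s - t)| with hc₂
  have hc₂0 : 0 ≤ c₂ := by positivity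
  set c₃ : ℝ := 2 ^ (s + 1) * 36 ^ t with hc₃
  have hc₃0 : 0 ≤ c₃ := by positivity
  set J : ℂ → ℝ≥0∞ := fun z => ∫⁻ ρ in Set.Ioo (1 - ℓ) ‖z‖,
    ‖deriv f (ρ * (z / (‖z‖ : ℂ)))‖ₑ ^ p * ENNReal.ofReal ((1 - ρ) ^ (p - 1 - (s - t))) with hJ
  have hpt : ∀ z ∈ tent θ ℓ, ‖f z‖ₑ ^ p ≤ ENNReal.ofReal (2 ^ (p - 1)) *
      (ENNReal.ofReal ((B * L) ^ p) * N ^ p + ENNReal.ofReal (c₁ * ℓ ^ (s - t)) * J z) := by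
    intro z hz
    have hu := norm_div_norm_of_mem_tent hℓ1 hz
    set u := z / (‖z‖ : ℂ) with hudef
    have hz0 : (‖z‖ : ℂ) ≠ 0 := by
      have : 0 < ‖z‖ := by linarith [hz.1]
      exact_mod_cast this.ne'
    have hzu : z = ‖z‖ * u := by rw [hudef, mul_div_cancel₀ _ hz0]
    have h1 := enorm_le_log_mul_fNorm hp ht hf hu (r := 1 - ℓ) (by linarith) (by linarith)
    rw [sub_sub_cancel, ← hL, ← hB, ← hN] at h1
    have h2 := enorm_sub_rpow_le_lintegral_radial hp hst hf hu hℓ hℓ1 hz.1.le hz.2.1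
    rw [← hzu] at h2
    calc ‖f z‖ₑ ^ p = ‖f ((1 - ℓ : ℝ) * u) + (f z - f ((1 - ℓ : ℝ) * u))‖ₑ ^ p := by
          rw [add_sub_cancel]
      _ ≤ (‖f ((1 - ℓ : ℝ) * u)‖ₑ + ‖f z - f ((1 - ℓ : ℝ) * u)‖ₑ) ^ p := by
          gcongr
          exact enorm_add_le _ _
      _ ≤ 2 ^ (p - 1) * (‖f ((1 - ℓ : ℝ) * u)‖ₑ ^ p + ‖f z - f ((1 - ℓ : ℝ) * u)‖ₑ ^ p) :=
          ENNReal.rpow_add_le_mul_rpow_add_rpow _ _ hp.le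
      _ ≤ _ := by
          rw [← ENNReal.ofReal_rpow_of_pos (by norm_num : (0 : ℝ) < 2), ENNReal.ofReal_ofNat]
          gcongr
          calc ‖f ((1 - ℓ : ℝ) * u)‖ₑ ^ p ≤ (ENNReal.ofReal (B * L) * N) ^ p := by gcongr
            _ = _ := by
              rw [ENNReal.mul_rpow_of_nonneg _ _ hp0.le,
                ENNReal.ofReal_rpow_of_nonneg (by positivity) hp0.le]
  calc ∫⁻ z in tent θ ℓ, ‖f z‖ₑ ^ p ∂μ
      ≤ ∫⁻ z in tent θ ℓ, ENNReal.ofReal (2 ^ (p - 1)) *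
          (ENNReal.ofReal ((B * L) ^ p) * N ^ p + ENNReal.ofReal (c₁ * ℓ ^ (s - t)) * J z) ∂μ :=
        setLIntegral_mono' (measurableSet_tent θ ℓ) hpt
    _ = ENNReal.ofReal (2 ^ (p - 1)) * (ENNReal.ofReal ((B * L) ^ p) * N ^ p * μ (tent θ ℓ) +
          ENNReal.ofReal (c₁ * ℓ ^ (s - t)) * ∫⁻ z in tent θ ℓ, J z ∂μ) := by
        rw [lintegral_const_mul' _ _ ENNReal.ofReal_ne_top, lintegral_add_left measurable_const,
          lintegral_const, Measure.restrict_apply_univ,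
          lintegral_const_mul' _ _ ENNReal.ofReal_ne_top]
    _ ≤ ENNReal.ofReal (2 ^ (p - 1)) * (ENNReal.ofReal ((B * L) ^ p) * N ^ p *
          (K * ENNReal.ofReal (ℓ ^ s)) + ENNReal.ofReal (c₁ * ℓ ^ (s - t)) *
            (ENNReal.ofReal c₂ * (K * (ENNReal.ofReal (c₃ * ℓ ^ t) * N ^ p)))) := by
        gcongr
        · exact measure_tent_le s μ hℓ hℓ1
        · refine (lintegral_tent_radial_le hp hs hμ hf hℓ hℓ1).trans ?_
          gcongr
          exact lintegral_window_le hp ht hs f hℓ hℓ1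
    _ = ENNReal.ofReal (2 ^ (p - 1)) * (ENNReal.ofReal ((B * L) ^ p) * ENNReal.ofReal (ℓ ^ s) +
          ENNReal.ofReal (c₁ * ℓ ^ (s - t)) * ENNReal.ofReal c₂ * ENNReal.ofReal (c₃ * ℓ ^ t)) *
            (K * N ^ p) := by ring
    _ = ENNReal.ofReal (2 ^ (p - 1) * ((B * L) ^ p * ℓ ^ s +
          c₁ * ℓ ^ (s - t) * c₂ * (c₃ * ℓ ^ t))) * (K * N ^ p) := by
        rw [← ENNReal.ofReal_mul (by positivity), ← ENNReal.ofReal_mul (by positivity),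
          ← ENNReal.ofReal_mul (by positivity), ← ENNReal.ofReal_add (by positivity)
            (by positivity), ← ENNReal.ofReal_mul (by positivity)]
    _ ≤ ENNReal.ofReal (embeddingConst p s t * (ℓ ^ s * L ^ p)) * (K * N ^ p) := by
        refine mul_le_mul' (ENNReal.ofReal_le_ofReal ?_) le_rfl
        have e1 : ℓ ^ s = ℓ ^ (s - t) * ℓ ^ t := by rw [← Real.rpow_add hℓ, sub_add_cancel]
        -- The increment term carries no logarithm, so one is inserted at the cost of `log 2 ^ p`.
        have e2 : 1 ≤ L ^ p / Real.log 2 ^ p := by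
          rw [one_le_div (by positivity)]
          gcongr
        rw [embeddingConst, ← hB, ← hc₁, ← hc₂, ← hc₃]
        calc 2 ^ (p - 1) * ((B * L) ^ p * ℓ ^ s + c₁ * ℓ ^ (s - t) * c₂ * (c₃ * ℓ ^ t))
            = 2 ^ (p - 1) * (B ^ p * L ^ p * ℓ ^ s + c₁ * c₂ * c₃ * ℓ ^ s * 1) := by
              rw [Real.mul_rpow hB0 hL0.le, e1]; ring
          _ ≤ 2 ^ (p - 1) * (B ^ p * L ^ p * ℓ ^ s +
                c₁ * c₂ * c₃ * ℓ ^ s * (L ^ p / Real.log 2 ^ p)) := by gcongr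
          _ = _ := by ring
    _ = _ := by
        have : 0 ≤ embeddingConst p s t := by
          rw [embeddingConst, ← hB, ← hc₁, ← hc₂, ← hc₃]
          positivity
        rw [ENNReal.ofReal_mul this]
        ring

theorem tentNorm_le_of_isCarleson {p s t : ℝ} (hp : 1 < p) (ht : 0 < t) (hts : t < s)
    {μ : Measure ℂ} (hμ : IsCarleson s μ) {f : ℂ → ℂ} (hf : DifferentiableOn ℂ f (ball 0 1)) :
    tentNorm s p μ f ≤ (ENNReal.ofReal (embeddingConst p s t) * carlesonNorm s μ) ^ (1 / p) *
      fNorm p (p - 2) t f := by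
  have hp0 : 0 < p := by linarith
  refine iSup_le fun θ => iSup₂_le fun ℓ hℓ => ?_
  have hlog : 0 < Real.log (2 / ℓ) :=
    Real.log_pos (by rw [lt_div_iff₀ hℓ.1]; linarith [hℓ.2])
  have hℓ0 := hℓ.1
  have h0 : ENNReal.ofReal (ℓ ^ s * Real.log (2 / ℓ) ^ p) ≠ 0 := by
    rw [Ne, ENNReal.ofReal_eq_zero, not_le]
    positivity
  rw [one_div, ENNReal.rpow_inv_le_iff hp0, ENNReal.mul_rpow_of_nonneg _ _ hp0.le,
    ENNReal.rpow_inv_rpow hp0.ne', ENNReal.div_le_iff h0 ENNReal.ofReal_ne_top]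
  exact lintegral_tent_enorm_rpow_le hp ht hts hμ hf hℓ.1 hℓ.2

/-- The identity maps `F(p, p - 2, t)` boundedly into the tent space of an `s`-Carleson measure. -/
theorem exists_bound_of_isCarleson {p s t : ℝ} (hp : 1 < p) (ht : 0 < t) (hts : t < s)
    {μ : Measure ℂ} (hμ : IsCarleson s μ) :
    ∃ C : ℝ≥0, ∀ f ∈ FSpace p (p - 2) t,
      f ∈ TentSpace s p μ ∧ tentNorm s p μ f ≤ C * fNorm p (p - 2) t f := by
  have hfin : (ENNReal.ofReal (embeddingConst p s t) * carlesonNorm s μ) ^ (1 / p) ≠ ∞ :=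
    ENNReal.rpow_ne_top_of_nonneg (by positivity)
      (ENNReal.mul_ne_top ENNReal.ofReal_ne_top (ne_of_lt hμ))
  refine ⟨((ENNReal.ofReal (embeddingConst p s t) * carlesonNorm s μ) ^ (1 / p)).toNNReal,
    fun f hf => ?_⟩
  rw [ENNReal.coe_toNNReal hfin]
  have h := tentNorm_le_of_isCarleson hp ht hts hμ hf.1
  exact ⟨⟨hf.1, h.trans_lt (ENNReal.mul_lt_top hfin.lt_top hf.2)⟩, h⟩

/-! ### Angular and radial integrals for the test functions -/

theorem lintegral_comp_add_abs_le (F : ℝ → ℝ≥0∞) (x : ℝ) :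
    ∫⁻ θ : ℝ, F (x + |θ|) ≤ 2 * ∫⁻ y in Set.Ioi x, F y := by
  have h1 : ∫⁻ θ in Set.Ioi (0 : ℝ), F (x + |θ|) = ∫⁻ y in Set.Ioi x, F y := by
    rw [← lintegral_indicator measurableSet_Ioi, ← lintegral_indicator measurableSet_Ioi,
      ← lintegral_add_left_eq_self ((Set.Ioi x).indicator F) x]
    refine lintegral_congr fun θ => ?_
    by_cases h : 0 < θ
    · rw [Set.indicator_of_mem (Set.mem_Ioi.2 h),
        Set.indicator_of_mem (Set.mem_Ioi.2 (by linarith)), abs_of_pos h]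
    · rw [Set.indicator_of_notMem (fun h' : θ ∈ Set.Ioi 0 => h h'),
        Set.indicator_of_notMem (fun h' : x + θ ∈ Set.Ioi x => h (by linarith [Set.mem_Ioi.1 h']))]
  have h2 : ∫⁻ θ in (Set.Ioi (0 : ℝ))ᶜ, F (x + |θ|) = ∫⁻ y in Set.Ioi x, F y := by
    rw [Set.compl_Ioi, setLIntegral_congr (Ioi_ae_eq_Ici (a := x)),
      ← lintegral_indicator measurableSet_Iic, ← lintegral_indicator measurableSet_Ici,
      ← lintegral_sub_left_eq_self ((Set.Ici x).indicator F) x]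
    refine lintegral_congr fun θ => ?_
    by_cases h : θ ≤ 0
    · rw [Set.indicator_of_mem (Set.mem_Iic.2 h),
        Set.indicator_of_mem (Set.mem_Ici.2 (by linarith)), abs_of_nonpos h, sub_eq_add_neg]
    · rw [Set.indicator_of_notMem (fun h' : θ ∈ Set.Iic 0 => h h'),
        Set.indicator_of_notMem (fun h' : x - θ ∈ Set.Ici x => h (by linarith [Set.mem_Ici.1 h']))]
  rw [← lintegral_add_compl _ (measurableSet_Ioi (a := (0 : ℝ))), h1, h2, two_mul]

/-- The distance dominates both `1 - c` and half the chord `‖1 - e‖`. Stating the bound with `r`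
instead of `c` makes it uniform in `a` when `c = ‖a‖ * r`. -/
theorem add_abs_le_norm_one_sub {c r θ : ℝ} (hc : 0 ≤ c) (hcr : c ≤ r) (hr : r < 1)
    (hθ : |θ| < Real.pi) :
    (1 - r + |θ|) / (2 * Real.pi) ≤ ‖1 - c * Complex.exp (θ * Complex.I)‖ := by
  have hpi := Real.pi_gt_three
  set e := Complex.exp (θ * Complex.I) with he
  have hen : ‖e‖ = 1 := Complex.norm_exp_ofReal_mul_I θ
  have h1 : 1 - c ≤ ‖1 - c * e‖ := by
    have := norm_sub_norm_le (1 : ℂ) (c * e)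
    rwa [norm_one, norm_mul, hen, mul_one, Complex.norm_real, Real.norm_of_nonneg hc] at this
  have h2 : ‖1 - e‖ ≤ 2 * ‖1 - c * e‖ := by
    have e1 : 1 - e = (1 - c * e) - (1 - c : ℝ) * e := by push_cast; ring
    rw [e1]
    refine (norm_sub_le _ _).trans ?_
    rw [norm_mul, hen, mul_one, Complex.norm_real, Real.norm_of_nonneg (by linarith)]
    linarith
  have h3 : |θ| ≤ Real.pi / 2 * ‖1 - e‖ := by
    have harg : e.arg = θ := by
      rw [he, Complex.arg_exp_mul_I, toIocMod_eq_self]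
      exact ⟨by linarith [(abs_lt.1 hθ).1], by linarith [(abs_lt.1 hθ).2]⟩
    have := Complex.angle_le_mul_norm_sub (x := 1) (y := e) norm_one hen
    rwa [Complex.angle_one_left (Complex.exp_ne_zero _), harg] at this
  rw [div_le_iff₀ (by positivity)]
  nlinarith [norm_nonneg (1 - c * e)]

theorem lintegral_angular_le {p c r : ℝ} (hp : 1 < p) (hc : 0 ≤ c) (hcr : c ≤ r) (hr : r < 1) :
    ∫⁻ θ in Set.Ioo (-Real.pi) Real.pi,
      ENNReal.ofReal (‖1 - c * Complex.exp (θ * Complex.I)‖ ^ (-p)) ≤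
    ENNReal.ofReal ((2 * Real.pi) ^ p * (2 / (p - 1)) * (1 - r) ^ (1 - p)) := by
  have hpi := Real.pi_pos
  have hx : 0 < 1 - r := by linarith
  have hp1 : 0 < p - 1 := by linarith
  calc _ ≤ ∫⁻ θ in Set.Ioo (-Real.pi) Real.pi,
        ENNReal.ofReal ((2 * Real.pi) ^ p) * ENNReal.ofReal ((1 - r + |θ|) ^ (-(p - 1) - 1)) := by
        refine setLIntegral_mono' measurableSet_Ioo fun θ hθ => ?_
        rw [← ENNReal.ofReal_mul (by positivity)]
        apply ENNReal.ofReal_le_ofReal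
        have h := add_abs_le_norm_one_sub hc hcr hr (abs_lt.2 ⟨hθ.1, hθ.2⟩)
        refine (Real.rpow_le_rpow_of_nonpos (by positivity) h (by linarith)).trans_eq ?_
        rw [Real.div_rpow (by positivity) (by positivity), Real.rpow_neg (by positivity) (y := p)
          (x := 2 * Real.pi), div_inv_eq_mul, mul_comm]
        congr 2
        ring
    _ ≤ ENNReal.ofReal ((2 * Real.pi) ^ p) *
          ∫⁻ θ : ℝ, ENNReal.ofReal ((1 - r + |θ|) ^ (-(p - 1) - 1)) := by
        rw [lintegral_const_mul' _ _ ENNReal.ofReal_ne_top]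
        gcongr
        exact Measure.restrict_le_self
    _ ≤ ENNReal.ofReal ((2 * Real.pi) ^ p) *
          (2 * ENNReal.ofReal ((1 - r) ^ (-(p - 1)) / (p - 1))) := by
        gcongr
        rw [← setLIntegral_rpow_Ioi hx hp1]
        exact lintegral_comp_add_abs_le (fun y => ENNReal.ofReal (y ^ (-(p - 1) - 1))) (1 - r)
    _ = _ := by
        rw [← ENNReal.ofReal_ofNat 2, ← ENNReal.ofReal_mul (by norm_num),
          ← ENNReal.ofReal_mul (by positivity), neg_sub]
        congr 1
        ring

/-- Split at `y`: the integrand decays like a power `t` away from `y` on either side, and each side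
contributes at most `1 / t` whatever `y` is. -/
theorem lintegral_min_rpow_le {t y : ℝ} (ht : 0 < t) (hy : 0 < y) :
    ∫⁻ x in Set.Ioo (0 : ℝ) 1, ENNReal.ofReal (x⁻¹ * min (x / y) (y / x) ^ t) ≤
      ENNReal.ofReal (2 / t) := by
  have hsub : Set.Ioo (0 : ℝ) 1 ⊆ Set.Ioc 0 y ∪ Set.Ioi y := by
    rw [Set.Ioc_union_Ioi_eq_Ioi hy.le]
    exact fun x hx => hx.1
  refine (lintegral_mono_set hsub).trans ((lintegral_union_le _ _ _).trans ?_)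
  have h1 : ∫⁻ x in Set.Ioc 0 y, ENNReal.ofReal (x⁻¹ * min (x / y) (y / x) ^ t) ≤
      ENNReal.ofReal (1 / t) := by
    rw [setLIntegral_congr (Ioo_ae_eq_Ioc (a := 0) (b := y)).symm]
    calc _ ≤ ∫⁻ x in Set.Ioo 0 y, ENNReal.ofReal (y ^ (-t)) * ENNReal.ofReal (x ^ (t - 1)) := by
          refine setLIntegral_mono' measurableSet_Ioo fun x hx => ?_
          have hx0 := hx.1
          rw [← ENNReal.ofReal_mul (by positivity)]
          apply ENNReal.ofReal_le_ofReal
          calc x⁻¹ * min (x / y) (y / x) ^ t ≤ x⁻¹ * (x / y) ^ t := by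
                gcongr
                exact min_le_left _ _
            _ = _ := by
              rw [Real.div_rpow hx0.le hy.le, Real.rpow_neg hy.le, Real.rpow_sub_one hx0.ne']
              field_simp
      _ = _ := by
          rw [lintegral_const_mul' _ _ ENNReal.ofReal_ne_top, setLIntegral_rpow_Ioo_zero hy.le ht,
            ← ENNReal.ofReal_mul (by positivity), Real.rpow_neg hy.le]
          congr 1
          field_simp
  have h2 : ∫⁻ x in Set.Ioi y, ENNReal.ofReal (x⁻¹ * min (x / y) (y / x) ^ t) ≤
      ENNReal.ofReal (1 / t) := by
    calc _ ≤ ∫⁻ x in Set.Ioi y, ENNReal.ofReal (y ^ t) * ENNReal.ofReal (x ^ (-t - 1)) := by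
          refine setLIntegral_mono' measurableSet_Ioi fun x hx => ?_
          have hx0 : 0 < x := hy.trans hx
          rw [← ENNReal.ofReal_mul (by positivity)]
          apply ENNReal.ofReal_le_ofReal
          calc x⁻¹ * min (x / y) (y / x) ^ t ≤ x⁻¹ * (y / x) ^ t := by
                gcongr
                exact min_le_right _ _
            _ = _ := by
              rw [Real.div_rpow hy.le hx0.le, Real.rpow_sub_one hx0.ne', Real.rpow_neg hx0.le]
              field_simp
      _ = _ := by
          rw [lintegral_const_mul' _ _ ENNReal.ofReal_ne_top, setLIntegral_rpow_Ioi hy ht,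
            ← ENNReal.ofReal_mul (by positivity), Real.rpow_neg hy.le]
          congr 1
          field_simp
  refine (add_le_add h1 h2).trans_eq ?_
  rw [← ENNReal.ofReal_add (by positivity) (by positivity)]
  congr 1
  ring

/-- Rotation invariance of area reduces to a nonnegative real parameter. -/
theorem lintegral_ball_norm_one_sub_conj_mul {G : ℝ → ℝ≥0∞} (hG : Measurable G) (p : ℝ) (a : ℂ) :
    ∫⁻ z in ball (0 : ℂ) 1, G ‖z‖ * ENNReal.ofReal (‖1 - conj a * z‖ ^ (-p)) =
      ∫⁻ z in ball (0 : ℂ) 1, G ‖z‖ * ENNReal.ofReal (‖1 - ‖a‖ * z‖ ^ (-p)) := by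
  set F : ℂ → ℝ≥0∞ := (ball (0 : ℂ) 1).indicator fun z =>
    G ‖z‖ * ENNReal.ofReal (‖1 - ‖a‖ * z‖ ^ (-p)) with hF
  have hFm : Measurable F := by
    refine Measurable.indicator ((hG.comp measurable_norm).mul ?_) measurableSet_ball
    fun_prop
  rw [← lintegral_indicator measurableSet_ball, ← lintegral_indicator measurableSet_ball, ← hF,
    ← (rotation (Circle.exp (-a.arg))).measurePreserving.lintegral_comp hFm]
  refine lintegral_congr fun z => ?_
  have hrot : (‖a‖ : ℂ) * rotation (Circle.exp (-a.arg)) z = conj a * z := by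
    have h : conj a = ‖a‖ * Complex.exp ((-a.arg : ℝ) * Complex.I) := by
      conv_lhs => rw [← Complex.norm_mul_exp_arg_mul_I a]
      rw [map_mul, Complex.conj_ofReal, ← Complex.exp_conj, map_mul, Complex.conj_I,
        Complex.conj_ofReal]
      congr 2
      push_cast
      ring
    rw [rotation_apply, Circle.coe_exp, h, mul_assoc]
  have hnorm : ‖rotation (Circle.exp (-a.arg)) z‖ = ‖z‖ := LinearIsometryEquiv.norm_map _ _
  by_cases hz : z ∈ ball (0 : ℂ) 1
  · have hz' : rotation (Circle.exp (-a.arg)) z ∈ ball (0 : ℂ) 1 := by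
      rw [mem_ball, dist_zero_right] at hz ⊢
      rwa [hnorm]
    rw [hF, Set.indicator_of_mem hz, Set.indicator_of_mem hz', hrot, hnorm]
  · have hz' : rotation (Circle.exp (-a.arg)) z ∉ ball (0 : ℂ) 1 := by
      rw [mem_ball, dist_zero_right] at hz ⊢
      rwa [hnorm]
    rw [hF, Set.indicator_of_notMem hz, Set.indicator_of_notMem hz']

/-! ### Logarithmic test functions -/

/-- The logarithmic test function attached to a point of the disc. -/
noncomputable def logTest (a z : ℂ) : ℂ := Real.log 12 - Complex.log (1 - conj a * z)

theorem one_sub_conj_mul_mem_slitPlane {a z : ℂ} (ha : ‖a‖ < 1) (hz : ‖z‖ < 1) :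
    1 - conj a * z ∈ Complex.slitPlane := by
  rw [sub_eq_add_neg]
  apply Complex.mem_slitPlane_of_norm_lt_one
  rw [norm_neg, norm_mul, RCLike.norm_conj]
  nlinarith [norm_nonneg a, norm_nonneg z]

theorem hasDerivAt_logTest {a z : ℂ} (ha : ‖a‖ < 1) (hz : ‖z‖ < 1) :
    HasDerivAt (logTest a) (conj a / (1 - conj a * z)) z := by
  have h1 : HasDerivAt (fun z => 1 - conj a * z) (-conj a) z := by
    simpa using ((hasDerivAt_id z).const_mul (conj a)).const_sub 1
  have h2 := (h1.clog (one_sub_conj_mul_mem_slitPlane ha hz)).const_sub (Real.log 12 : ℂ)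
  rwa [neg_div, neg_neg] at h2

theorem differentiableOn_logTest {a : ℂ} (ha : ‖a‖ < 1) :
    DifferentiableOn ℂ (logTest a) (ball 0 1) := fun z hz =>
  (hasDerivAt_logTest ha (by simpa using hz)).differentiableAt.differentiableWithinAt

/-- The constant bounding the seminorms of the logarithmic test functions. -/
noncomputable def logTestConst (p t : ℝ) : ℝ :=
  2 ^ |p - 2| * 4 ^ t * ((2 * Real.pi) ^ p * (2 / (p - 1))) * (2 / t)

/-- Both `1 - ‖z‖` and `1 - ‖b‖` are at most `‖1 - conj b * z‖`; using either one in the denominator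
of `1 - ‖φ_b z‖ ^ 2` gives the two entries of the minimum. The bound depends on `b` only through
`‖b‖`, which allows polar integration. -/
theorem logTest_integrand_le {p t : ℝ} (hp : 0 < p) (ht : 0 < t) {a b z : ℂ} (ha : ‖a‖ < 1)
    (hb : ‖b‖ < 1) (hz : ‖z‖ < 1) :
    ‖deriv (logTest a) z‖ ^ p * (1 - ‖z‖ ^ 2) ^ (p - 2) * (1 - ‖mobius b z‖ ^ 2) ^ t ≤
      2 ^ |p - 2| * 4 ^ t * ((1 - ‖z‖) ^ (p - 2) *
        min ((1 - ‖z‖) / (1 - ‖b‖)) ((1 - ‖b‖) / (1 - ‖z‖)) ^ t) *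
        ‖1 - conj a * z‖ ^ (-p) := by
  have hx : 0 < 1 - ‖z‖ := by linarith
  have hy : 0 < 1 - ‖b‖ := by linarith
  have hbn := norm_nonneg b
  have hzn := norm_nonneg z
  have hda := norm_one_sub_conj_mul_pos ha hz
  have hdb := norm_one_sub_conj_mul_pos hb hz
  have hD := one_sub_norm_le_norm_one_sub_conj_mul (a := b) (z := z)
  set D := ‖1 - conj b * z‖ with hDdef
  have hDx : 1 - ‖z‖ ≤ D := by nlinarith
  have hDy : 1 - ‖b‖ ≤ D := by nlinarith
  have hbb : 1 - ‖b‖ ^ 2 ≤ 2 * (1 - ‖b‖) := by nlinarith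
  have hzz : 1 - ‖z‖ ^ 2 ≤ 2 * (1 - ‖z‖) := by nlinarith
  have hz2 : 0 < 1 - ‖z‖ ^ 2 := by nlinarith
  have hb2 : 0 < 1 - ‖b‖ ^ 2 := by nlinarith
  have h1 : ‖deriv (logTest a) z‖ ^ p ≤ ‖1 - conj a * z‖ ^ (-p) := by
    rw [(hasDerivAt_logTest ha hz).deriv, norm_div, RCLike.norm_conj,
      Real.rpow_neg hda.le, ← Real.inv_rpow hda.le]
    refine Real.rpow_le_rpow (by positivity) ?_ hp.le
    rw [inv_eq_one_div]
    gcongr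
  have h2 : (1 - ‖z‖ ^ 2) ^ (p - 2) ≤ 2 ^ |p - 2| * (1 - ‖z‖) ^ (p - 2) :=
    rpow_le_mul_rpow_of_comparable _ hx (by norm_num) (by nlinarith) hzz
  have hm0 : 0 ≤ 1 - ‖mobius b z‖ ^ 2 := by
    rw [one_sub_norm_mobius_sq (norm_pos_iff.1 hdb)]
    positivity
  have h3 : (1 - ‖mobius b z‖ ^ 2) ^ t ≤
      4 ^ t * min ((1 - ‖z‖) / (1 - ‖b‖)) ((1 - ‖b‖) / (1 - ‖z‖)) ^ t := by
    have hmin : 0 ≤ min ((1 - ‖z‖) / (1 - ‖b‖)) ((1 - ‖b‖) / (1 - ‖z‖)) := by positivity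
    rw [← Real.mul_rpow (by norm_num) hmin]
    refine Real.rpow_le_rpow hm0 ?_ ht.le
    rw [one_sub_norm_mobius_sq (norm_pos_iff.1 hdb), ← hDdef]
    have hprod : (1 - ‖b‖ ^ 2) * (1 - ‖z‖ ^ 2) ≤ 2 * (1 - ‖b‖) * (2 * (1 - ‖z‖)) := by gcongr
    rw [mul_min_of_nonneg _ _ (by norm_num : (0 : ℝ) ≤ 4)]
    refine le_min ?_ ?_
    · calc _ ≤ 2 * (1 - ‖b‖) * (2 * (1 - ‖z‖)) / (1 - ‖b‖) ^ 2 := by gcongr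
        _ = _ := by field_simp; norm_num
    · calc _ ≤ 2 * (1 - ‖b‖) * (2 * (1 - ‖z‖)) / (1 - ‖z‖) ^ 2 := by gcongr
        _ = _ := by field_simp; norm_num
  calc _ ≤ ‖1 - conj a * z‖ ^ (-p) * (2 ^ |p - 2| * (1 - ‖z‖) ^ (p - 2)) *
        (4 ^ t * min ((1 - ‖z‖) / (1 - ‖b‖)) ((1 - ‖b‖) / (1 - ‖z‖)) ^ t) := by
        gcongr
    _ = _ := by ring

/-- The angular integral is at most a constant times `(1 - r) ^ (1 - p)`, which reduces the weight
`(1 - r) ^ (p - 2)` to `(1 - r)⁻¹`. The minimum makes the remaining logarithmically divergent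
integral converge, uniformly in `a` and `b`. -/
theorem lintegral_logTest_le {p t : ℝ} (hp : 1 < p) (ht : 0 < t) {a b : ℂ} (ha : ‖a‖ < 1)
    (hb : ‖b‖ < 1) :
    ∫⁻ z in ball (0 : ℂ) 1, ENNReal.ofReal
      (‖deriv (logTest a) z‖ ^ p * (1 - ‖z‖ ^ 2) ^ (p - 2) * (1 - ‖mobius b z‖ ^ 2) ^ t) ≤
    ENNReal.ofReal (logTestConst p t) := by
  have hy : 0 < 1 - ‖b‖ := by linarith
  have hp1 : 0 < p - 1 := by linarith
  have hpi := Real.pi_pos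
  set k := (2 : ℝ) ^ |p - 2| * 4 ^ t with hk
  set k' := (2 * Real.pi) ^ p * (2 / (p - 1)) with hk'
  have hk0 : 0 ≤ k := by positivity
  have hk0' : 0 ≤ k' := by positivity
  set G : ℝ → ℝ≥0∞ := fun r => ENNReal.ofReal (k * ((1 - r) ^ (p - 2) *
    min ((1 - r) / (1 - ‖b‖)) ((1 - ‖b‖) / (1 - r)) ^ t)) with hG
  have hGm : Measurable G := by fun_prop
  calc _ ≤ ∫⁻ z in ball (0 : ℂ) 1, G ‖z‖ * ENNReal.ofReal (‖1 - conj a * z‖ ^ (-p)) := by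
        refine setLIntegral_mono' measurableSet_ball fun z hz => ?_
        have hz1 : ‖z‖ < 1 := by simpa using hz
        have hx : 0 < 1 - ‖z‖ := by linarith
        rw [hG, ← ENNReal.ofReal_mul (by positivity)]
        exact ENNReal.ofReal_le_ofReal (logTest_integrand_le (by linarith) ht ha hb hz1)
    _ = ∫⁻ z in ball (0 : ℂ) 1, G ‖z‖ * ENNReal.ofReal (‖1 - ‖a‖ * z‖ ^ (-p)) :=
        lintegral_ball_norm_one_sub_conj_mul hGm p a
    _ = ∫⁻ r in Set.Ioo (0 : ℝ) 1, ENNReal.ofReal r * ∫⁻ θ in Set.Ioo (-Real.pi) Real.pi,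
          G ‖(r * Complex.exp (θ * Complex.I) : ℂ)‖ *
            ENNReal.ofReal (‖1 - ‖a‖ * (r * Complex.exp (θ * Complex.I))‖ ^ (-p)) := by
        refine lintegral_ball_eq_polar
          (F := fun z => G ‖z‖ * ENNReal.ofReal (‖1 - ‖a‖ * z‖ ^ (-p))) ?_ 1
        exact (hGm.comp measurable_norm).mul (by fun_prop)
    -- The endpoints are written so that `setLIntegral_one_sub` applies.
    _ ≤ ∫⁻ r in Set.Ioo (1 - 1 : ℝ) (1 - 0), ENNReal.ofReal (k * k') * ENNReal.ofReal
          ((1 - r)⁻¹ * min ((1 - r) / (1 - ‖b‖)) ((1 - ‖b‖) / (1 - r)) ^ t) := by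
        rw [sub_self, sub_zero]
        refine setLIntegral_mono' measurableSet_Ioo fun r hr => ?_
        have hr0 := hr.1
        have hx : 0 < 1 - r := by linarith [hr.2]
        have hn : ∀ θ : ℝ, ‖(r * Complex.exp (θ * Complex.I) : ℂ)‖ = r := fun θ => by
          rw [norm_mul, Complex.norm_exp_ofReal_mul_I, mul_one, Complex.norm_real,
            Real.norm_of_nonneg hr0.le]
        have he : ∀ θ : ℝ, (‖a‖ : ℂ) * (r * Complex.exp (θ * Complex.I)) =
            (‖a‖ * r : ℝ) * Complex.exp (θ * Complex.I) := fun θ => by push_cast; ring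
        simp only [hn, he]
        rw [lintegral_const_mul' _ _ ENNReal.ofReal_ne_top]
        calc _ ≤ 1 * (G r * ENNReal.ofReal (k' * (1 - r) ^ (1 - p))) := by
              gcongr
              · rw [← ENNReal.ofReal_one]
                exact ENNReal.ofReal_le_ofReal hr.2.le
              · exact lintegral_angular_le hp (by positivity)
                  (mul_le_of_le_one_left hr0.le ha.le) hr.2
          _ = _ := by
              rw [one_mul, hG, ← ENNReal.ofReal_mul (by positivity),
                ← ENNReal.ofReal_mul (by positivity)]
              congr 1
              have : (1 - r)⁻¹ = (1 - r) ^ (p - 2) * (1 - r) ^ (1 - p) := by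
                rw [← Real.rpow_add hx, ← Real.rpow_neg_one]
                congr 1
                ring
              rw [this]
              ring
    _ = ENNReal.ofReal (k * k') * ∫⁻ x in Set.Ioo (0 : ℝ) 1, ENNReal.ofReal
          (x⁻¹ * min (x / (1 - ‖b‖)) ((1 - ‖b‖) / x) ^ t) := by
        rw [lintegral_const_mul' _ _ ENNReal.ofReal_ne_top,
          setLIntegral_one_sub (fun x => ENNReal.ofReal
            (x⁻¹ * min (x / (1 - ‖b‖)) ((1 - ‖b‖) / x) ^ t))]
    _ ≤ ENNReal.ofReal (k * k') * ENNReal.ofReal (2 / t) := by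
        gcongr
        exact lintegral_min_rpow_le ht hy
    _ = _ := by rw [← ENNReal.ofReal_mul (by positivity), logTestConst]

theorem fNorm_logTest_le {p t : ℝ} (hp : 1 < p) (ht : 0 < t) {a : ℂ} (ha : ‖a‖ < 1) :
    fNorm p (p - 2) t (logTest a) ≤
      ‖(Real.log 12 : ℂ)‖ₑ + ENNReal.ofReal (logTestConst p t) ^ (1 / p) := by
  refine add_le_add (by simp [logTest]) (iSup₂_le fun b hb => ?_)
  have hp0 : 0 ≤ 1 / p := by positivity
  exact ENNReal.rpow_le_rpow (lintegral_logTest_le hp ht ha (by simpa using hb)) hp0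

/-- The tent lies where `‖1 - conj a * z‖ ≤ 6 * ℓ`; the constant `12` is chosen so that `12 / (6 *
ℓ) = 2 / ℓ`. The real part alone gives the bound. -/
theorem log_le_norm_logTest {θ ℓ : ℝ} (hℓ : 0 < ℓ) (hℓ1 : ℓ ≤ 1) {z : ℂ} (hz : z ∈ tent θ ℓ) :
    Real.log (2 / ℓ) ≤ ‖logTest (tentCenter θ ℓ) z‖ := by
  have hc : ‖tentCenter θ ℓ‖ < 1 := by rw [norm_tentCenter θ hℓ1]; linarith
  have hden := norm_one_sub_conj_mul_pos hc hz.2.1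
  have hu := norm_div_norm_of_mem_tent hℓ1 hz
  have harc := norm_sub_le_of_mem_arc hz.2.2
  have hz0 : (‖z‖ : ℂ) ≠ 0 := by
    have : 0 < ‖z‖ := by linarith [hz.1]
    exact_mod_cast this.ne'
  set u := z / (‖z‖ : ℂ) with hudef
  have hzu : z = ‖z‖ * u := by rw [hudef, mul_div_cancel₀ _ hz0]
  have hu2 : ‖u - z‖ = 1 - ‖z‖ := by
    nth_rewrite 1 [hzu]
    rw [← one_sub_mul, norm_mul, hu, mul_one, ← Complex.ofReal_one, ← Complex.ofReal_sub,
      Complex.norm_real, Real.norm_of_nonneg (by linarith [hz.2.1])]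
  have h6 : ‖1 - conj (tentCenter θ ℓ) * z‖ ≤ 6 * ℓ := by
    refine (norm_one_sub_conj_tentCenter_mul_le hℓ hℓ1 z).trans ?_
    have h := norm_sub_le_norm_sub_add_norm_sub (Complex.exp (θ * Complex.I)) u z
    rw [norm_sub_rev _ u, hu2] at h
    nlinarith [Real.pi_lt_d2, hz.1]
  calc Real.log (2 / ℓ) = Real.log 12 - Real.log (6 * ℓ) := by
        rw [← Real.log_div (by norm_num) (by positivity)]
        congr 1
        field_simp
        norm_num
    _ ≤ Real.log 12 - Real.log ‖1 - conj (tentCenter θ ℓ) * z‖ := by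
        gcongr
    _ = (logTest (tentCenter θ ℓ) z).re := by
        rw [logTest, Complex.sub_re, Complex.ofReal_re, Complex.log_re]
    _ ≤ _ := Complex.re_le_norm _

/-! ### Necessity and the equivalence -/

/-- If the identity is bounded from `F(p, p - 2, t)` into the tent space of `μ`, then `μ` is an
`s`-Carleson measure. -/
theorem isCarleson_of_bound {p s t : ℝ} (hp : 1 < p) (ht : 0 < t) {μ : Measure ℂ} {C : ℝ≥0}
    (hC : ∀ f ∈ FSpace p (p - 2) t, tentNorm s p μ f ≤ C * fNorm p (p - 2) t f) :
    IsCarleson s μ := by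
  have hp0 : 0 < p := by linarith
  set M := ‖(Real.log 12 : ℂ)‖ₑ + ENNReal.ofReal (logTestConst p t) ^ (1 / p) with hM
  have hMt : M ≠ ∞ := ENNReal.add_ne_top.2
    ⟨enorm_ne_top, ENNReal.rpow_ne_top_of_nonneg (by positivity) ENNReal.ofReal_ne_top⟩
  have hbound : carlesonNorm s μ ≤ (C * M) ^ p := by
    refine iSup_le fun θ => iSup₂_le fun ℓ hℓ => ?_
    obtain ⟨hℓ0, hℓ1⟩ := hℓ
    have hc : ‖tentCenter θ ℓ‖ < 1 := by rw [norm_tentCenter θ hℓ1]; linarith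
    have hN := fNorm_logTest_le hp ht hc
    have h1 := hC (logTest (tentCenter θ ℓ))
      ⟨differentiableOn_logTest hc, hN.trans_lt hMt.lt_top⟩
    have hlog : 0 < Real.log (2 / ℓ) := Real.log_pos (by rw [lt_div_iff₀ hℓ0]; linarith)
    have h2 : ((∫⁻ z in tent θ ℓ, ‖logTest (tentCenter θ ℓ) z‖ₑ ^ p ∂μ) /
        ENNReal.ofReal (ℓ ^ s * Real.log (2 / ℓ) ^ p)) ^ (1 / p) ≤ C * M :=
      ((le_iSup₂ (f := fun (ℓ : ℝ) (_ : ℓ ∈ Set.Ioc (0 : ℝ) 1) =>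
        ((∫⁻ z in tent θ ℓ, ‖logTest (tentCenter θ _) z‖ₑ ^ p ∂μ) /
          ENNReal.ofReal (ℓ ^ s * Real.log (2 / ℓ) ^ p)) ^ (1 / p)) ℓ ⟨hℓ0, hℓ1⟩).trans
        (le_iSup (fun θ' : ℝ => ⨆ (ℓ' ∈ Set.Ioc (0 : ℝ) 1),
          ((∫⁻ z in tent θ' ℓ', ‖logTest (tentCenter θ ℓ) z‖ₑ ^ p ∂μ) /
            ENNReal.ofReal (ℓ' ^ s * Real.log (2 / ℓ') ^ p)) ^ (1 / p)) θ)).trans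
        (h1.trans (mul_le_mul_right hN _))
    rw [one_div, ENNReal.rpow_inv_le_iff hp0] at h2
    refine le_trans ?_ h2
    have hlow : ENNReal.ofReal (Real.log (2 / ℓ) ^ p) * μ (tent θ ℓ) ≤
        ∫⁻ z in tent θ ℓ, ‖logTest (tentCenter θ ℓ) z‖ₑ ^ p ∂μ := by
      rw [← setLIntegral_const]
      refine setLIntegral_mono' (measurableSet_tent θ ℓ) fun z hz => ?_
      rw [enorm_rpow_eq_ofReal _ hp0.le]
      exact ENNReal.ofReal_le_ofReal
        (Real.rpow_le_rpow hlog.le (log_le_norm_logTest hℓ0 hℓ1 hz) hp0.le)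
    calc μ (tent θ ℓ) / ENNReal.ofReal (ℓ ^ s)
        = ENNReal.ofReal (Real.log (2 / ℓ) ^ p) * μ (tent θ ℓ) /
            (ENNReal.ofReal (Real.log (2 / ℓ) ^ p) * ENNReal.ofReal (ℓ ^ s)) := by
          rw [ENNReal.mul_div_mul_left _ _ _ ENNReal.ofReal_ne_top]
          rw [Ne, ENNReal.ofReal_eq_zero, not_le]
          positivity
      _ ≤ _ := by
          rw [mul_comm (ℓ ^ s), ENNReal.ofReal_mul (by positivity)]
          gcongr
  exact hbound.trans_lt
    (ENNReal.rpow_lt_top_of_nonneg hp0.le (ENNReal.mul_ne_top ENNReal.coe_ne_top hMt))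

end NearEndpoint

theorem mainTheorem2 (p s t : ℝ) (hp : 1 < p) (ht : 0 < t) (hts : t < s) (hs : s ≤ 1)
    (μ : Measure ℂ) (hμ : μ (ball (0 : ℂ) 1)ᶜ = 0) :
    (∃ C : ℝ≥0, ∀ f ∈ NearEndpoint.FSpace p (p - 2) t,
        f ∈ NearEndpoint.TentSpace s p μ ∧
          NearEndpoint.tentNorm s p μ f ≤ C * NearEndpoint.fNorm p (p - 2) t f) ↔
      NearEndpoint.IsCarleson s μ :=
  ⟨fun ⟨_, hC⟩ => NearEndpoint.isCarleson_of_bound hp ht fun f hf => (hC f hf).2,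
    fun h => NearEndpoint.exists_bound_of_isCarleson hp ht hts h⟩
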